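/- Setting. Let $\mathcal S,\mathcal Y$ be standard Borel spaces, $\mathcal A$ a measurable space, $\mathcal O$ a non-empty compact metric space with its Borel $\sigma$-algebra, and $T\in\mathbb N$. A class of MDPs $\mathcal M$ is given by Markov kernels $\mathbb P_{S_1\mid\Theta}$, $p(\cdot\mid s,a,\theta)$ (law of $S_{t+1}$ given $S_t=s,A_t=a,\Theta=\theta$), $y(\cdot\mid s,\theta)$ (law of $Y_t$ given $S_t=s,\Theta=\theta$) and a measurable reward $r:\mathcal Y\times\mathcal A\to\mathbb R$. Given the past up to $S_t$ and $\Theta$, the outcome $Y_t$ does not depend on $A_t$, and given also $A_t$, $S_{t+1}$ does not depend on $Y_t$. The history $H^t$ consists of the triples $(S_k,A_k,Y_k)$, $k<t$. A policy is a family $\pi=(\pi_t)_{t=1}^T$ of measurable maps $(S_t,H^t)\mapsto A_t$; $\mathcal P$ is the set of all policies. Put $$U(\pi,\theta)=\mathbb E^\theta\Big[\sum_{t=1}^T r(Y_t,\pi_t(S_t,H^t))\Big],\qquad U^*(\theta)=\sup_{g:\mathcal S\to\mathcal A}\mathbb E^\theta\Big[\sum_{t=1}^T r(Y_t,g(S_t))\Big],\qquad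 \mathfrak R(\pi,\theta)=U^*(\theta)-U(\pi,\theta).$$ The rewards are integrable under every policy and parameter. Let $\mathcal P$ carry a metric with its Borel $\sigma$-algebra, such that $\mathfrak R(\cdot,\theta)$ is measurable for each $\theta$. The minimax regret is $$\mathfrak M_{\mathcal M}=\inf_{\mathbb P_\Pi\in\Delta(\mathcal P)}\ \sup_{\theta\in\mathcal O}\ \mathbb E_\Pi[\mathfrak R(\Pi,\theta)],$$ where $\Delta(\cdot)$ denotes the set of Borel probability measures. Assume that $\mathfrak R$ is bounded on $\mathcal P\times\mathcal O$ and that $\mathfrak R(\pi,\cdot)$ is continuous on $\mathcal O$ for every $\pi\in\mathcal P$. For every prior $\mathbb P_\Theta\in\Delta(\mathcal O)$ let $f^\star:\mathcal S\times\mathcal O\to\mathcal A$ be measurable, with integrable rewards, and maximise $\mathbb E[\sum_{t=1}^T r(Y_t,f(S_t,\Theta))]$ over all $f:\mathcal S\times\mathcal O\to\mathcal A$ with measurable sections $f(\cdot,\theta)$ for which this expectation exists (such an $f^\star$, which may depend on $\mathbb P_\Theta$, is assumed to exist). Let $S_t^\star,Y_t^\star$ be the states and outcomes when $A_t=f^\star(S_t,\Theta)$.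 Let $\hat S_t,\hat Y_t,\hat H^t$ be the states, outcomes and histories under Thompson sampling: at time $t$ draw $\hat\Theta_t$ from the posterior $\mathbb P_{\Theta\mid\hat H^t}$ and play $\hat A_t=f^\star(\hat S_t,\hat\Theta_t)$. Theorem. (1) Let $\sigma_1,\dots,\sigma_T>0$. Suppose that for every prior $\mathbb P_\Theta$, every $t$, almost every value $h$ of $\hat H^t$ and every $\theta\in\mathcal O$, the variable $r(\hat Y_t,f^\star(\hat S_t,\theta))$ is $\sigma_t^2$-sub-Gaussian under $\mathbb P_{\hat Y_t,\hat S_t\mid\hat H^t=h}$, i.e. its centred version $X$ satisfies $\mathbb E[e^{uX}]\le e^{\sigma_t^2u^2/2}$ for all $u\in\mathbb R$. Then $$\mathfrak M_{\mathcal M}\le\sup_{\mathbb P_\Theta\in\Delta(\mathcal O)}\sum_{t=1}^T\mathbb E\Big[\sqrt{2\sigma_t^2\,D_{KL}\big(\mathbb P_{Y_t^\star,S_t^\star\mid\Theta}\,\|\,\mathbb P_{\hat Y_t,\hat S_t\mid\hat H^t}\big)}\Big].$$ (2) Let $\rho$ be a separable metric on $\mathcal Y\times\mathcal A$ whose Borel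 $\sigma$-algebra is the product $\sigma$-algebra, and let $r$ be $L$-Lipschitz with respect to $\rho$, $L\ge0$. Then $$\mathfrak M_{\mathcal M}\le\sup_{\mathbb P_\Theta\in\Delta(\mathcal O)}L\sum_{t=1}^T\mathbb E\Big[W\big(\mathbb P_{Y_t^\star,S_t^\star\mid\Theta},\mathbb P_{\hat Y_t,\hat S_t\mid\hat H^t}\big)\Big],$$ where $W$ is the Wasserstein distance on $\mathcal Y\times\mathcal S$ induced by $\rho$ through the optimal action: for $\Theta=\theta$, $W(P,Q)$ is the infimum over all couplings $D$ of $P$ and $Q$ of $\int\rho\big((y,f^\star(s,\theta)),(y',f^\star(s',\theta))\big)\,dD((y,s),(y',s'))$. The expectations on the right-hand sides are over the joint law of $(\Theta,\hat H^t)$; both sides of the inequalities are extended real numbers and $L\cdot\infty=0$ for $L=0$. -/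

import Mathlib

open MeasureTheory ProbabilityTheory InformationTheory
open scoped ENNReal NNReal

noncomputable section

/-- A class of finite-horizon MDPs with states `S`, actions `A`, outcomes `Y`, parametrised by
`O`: the horizon, the law of the first state given the parameter, the transition kernel
`(s, a, θ) ↦ law of the next state`, the outcome kernel `(s, θ) ↦ law of the outcome`, and the
reward `r (y, a)`. -/
structure MDPClass (S A Y O : Type*) [MeasurableSpace S] [MeasurableSpace A] [MeasurableSpace Y]
    [MeasurableSpace O] where
  /-- The number of time steps. -/
  horizon : ℕ
  /-- Law of the initial state given the parameter. -/
  init : Kernel O S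
  /-- Transition kernel. -/
  trans : Kernel (S × A × O) S
  /-- Outcome kernel. -/
  out : Kernel (S × O) Y
  /-- Reward as a function of outcome and action. -/
  reward : Y × A → ℝ
  markov_init : IsMarkovKernel init
  markov_trans : IsMarkovKernel trans
  markov_out : IsMarkovKernel out
  measurable_reward : Measurable reward

/-- Histories available before acting at time `t` (times are `0, …, T - 1`): the `t` past triples
(state, action, outcome). -/
abbrev Hist (S A Y : Type*) (t : ℕ) : Type _ := Fin t → S × A × Y

/-- Deterministic policies: at each time `t < T` a measurable map from the history and the current
state to an action. -/
def Policy (S A Y : Type*) [MeasurableSpace S] [MeasurableSpace A] [MeasurableSpace Y]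
    (T : ℕ) : Type _ :=
  {π : (t : Fin T) → Hist S A Y t × S → A // ∀ t, Measurable (π t)}

/-- Adding the triple of the current time to the history and passing to the next state. -/
def extend {S A Y : Type*} (t : ℕ) (x : (((Hist S A Y t × S) × A) × Y) × S) :
    Hist S A Y (t + 1) × S :=
  (Fin.snoc x.1.1.1.1 (x.1.1.1.2, x.1.1.2, x.1.2), x.2)

theorem measurable_extend {S A Y : Type*} [MeasurableSpace S] [MeasurableSpace A]
    [MeasurableSpace Y] (t : ℕ) : Measurable (extend (S := S) (A := A) (Y := Y) t) := by
  refine Measurable.prodMk ?_ measurable_snd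
  refine measurable_pi_iff.2 fun i => ?_
  induction i using Fin.lastCases with
  | last => simp only [Fin.snoc_last]; fun_prop
  | cast i => simp only [Fin.snoc_castSucc]; fun_prop

/-- The transport cost between `P` and `Q`: infimum over all couplings of the expected cost. For a
metric `c` this is the Wasserstein distance. -/
def transportCost {X : Type*} [MeasurableSpace X] (c : X → X → ℝ≥0∞) (P Q : Measure X) : ℝ≥0∞ :=
  ⨅ (D : Measure (X × X)) (_ : D.fst = P ∧ D.snd = Q), ∫⁻ z, c z.1 z.2 ∂D

namespace MDPClass

variable {S A Y O : Type*} [MeasurableSpace S] [MeasurableSpace A] [MeasurableSpace Y]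
  [MeasurableSpace O] (M : MDPClass S A Y O)

/-- A rule for choosing actions, possibly randomised and possibly depending on the parameter: the
law of the action at time `t` given parameter, history and current state. -/
abbrev Rule (S A Y O : Type*) [MeasurableSpace S] [MeasurableSpace A] [MeasurableSpace Y]
    [MeasurableSpace O] : Type _ :=
  (t : ℕ) → Kernel (O × (Hist S A Y t × S)) A

/-- Law of (history, state) at time `0`: empty history and a state drawn from `init`. -/
def start : Kernel O (Hist S A Y 0 × S) :=
  M.init.map fun s => (Fin.elim0, s)

/-- Given the law `K` of (history, state) at time `t` and the conditional law `D` of the action,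
the law of (history, state, action, outcome) at time `t`. -/
def actStep {t : ℕ} (K : Kernel O (Hist S A Y t × S)) (D : Kernel (O × (Hist S A Y t × S)) A) :
    Kernel O (((Hist S A Y t × S) × A) × Y) :=
  (K.compProd D).compProd
    (M.out.comap (fun x : O × ((Hist S A Y t × S) × A) => (x.2.1.2, x.1)) (by fun_prop))

/-- Given the law `K` of (history, state) at time `t` and the conditional law `D` of the action,
the law of (history, state) at time `t + 1`. -/
def nextStep {t : ℕ} (K : Kernel O (Hist S A Y t × S)) (D : Kernel (O × (Hist S A Y t × S)) A) :
    Kernel O (Hist S A Y (t + 1) × S) :=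
  ((M.actStep K D).compProd
    (M.trans.comap (fun x : O × (((Hist S A Y t × S) × A) × Y) => (x.2.1.1.2, x.2.1.2, x.1))
      (by fun_prop))).map (extend t)

instance : IsMarkovKernel M.start := by
  have := M.markov_init
  exact Kernel.IsMarkovKernel.map _ (by fun_prop)

theorem isMarkovKernel_actStep {t : ℕ} (K : Kernel O (Hist S A Y t × S))
    (D : Kernel (O × (Hist S A Y t × S)) A) [IsMarkovKernel K] [IsMarkovKernel D] :
    IsMarkovKernel (M.actStep K D) := by
  have := M.markov_out
  unfold actStep
  infer_instance

theorem isMarkovKernel_nextStep {t : ℕ} (K : Kernel O (Hist S A Y t × S))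
    (D : Kernel (O × (Hist S A Y t × S)) A) [IsMarkovKernel K] [IsMarkovKernel D] :
    IsMarkovKernel (M.nextStep K D) := by
  have := M.markov_trans
  have := M.isMarkovKernel_actStep K D
  exact Kernel.IsMarkovKernel.map _ (measurable_extend t)

/-- For each parameter, the law of (history, state) at time `t` when actions follow `D`. -/
def stateLaw (D : Rule S A Y O) : (t : ℕ) → Kernel O (Hist S A Y t × S)
  | 0 => M.start
  | t + 1 => M.nextStep (stateLaw D t) (D t)

/-- For each parameter, the law of (history, state, action, outcome) at time `t` when actions
follow `D`. -/
def stageLaw (D : Rule S A Y O) (t : ℕ) : Kernel O (((Hist S A Y t × S) × A) × Y) :=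
  M.actStep (M.stateLaw D t) (D t)

/-- The reward received at a stage. -/
def stageReward {t : ℕ} (x : ((Hist S A Y t × S) × A) × Y) : ℝ := M.reward (x.2, x.1.2)

/-- A policy as a rule (only times before the horizon matter; there is no action later on). -/
def policyRule {T : ℕ} (π : Policy S A Y T) : Rule S A Y O := fun t =>
  if h : t < T then
    Kernel.deterministic (fun x : O × (Hist S A Y t × S) => π.1 ⟨t, h⟩ x.2)
      ((π.2 ⟨t, h⟩).comp measurable_snd)
  else 0

/-- The rule that plays `f (S_t, Θ)`, knowing the parameter. -/
def paramRule (f : {f : S × O → A // Measurable f}) : Rule S A Y O := fun t =>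
  Kernel.deterministic (fun x : O × (Hist S A Y t × S) => f.1 (x.2.2, x.1))
    (f.2.comp (by fun_prop))

/-- Utility `E^θ [∑ t, r (Y_t, π_t (S_t, H^t))]` of a policy. -/
def utility (π : Policy S A Y M.horizon) (θ : O) : ℝ :=
  ∑ t : Fin M.horizon, ∫ x, M.stageReward x ∂(M.stageLaw (policyRule π) t θ)

/-- All rewards are integrable, so that the utilities are genuine expectations. -/
def RewardsIntegrable : Prop :=
  ∀ (π : Policy S A Y M.horizon) (θ : O) (t : Fin M.horizon),
    Integrable M.stageReward (M.stageLaw (policyRule π) t θ)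

/-- The policy that plays `g (S_t)` at all times. -/
def stationary (T : ℕ) (g : {g : S → A // Measurable g}) : Policy S A Y T :=
  ⟨fun _ x => g.1 x.2, fun _ => g.2.comp measurable_snd⟩

/-- Optimal utility `U^* θ`: supremum over maps `S → A`. -/
def optimalUtility (θ : O) : ℝ :=
  ⨆ g : {g : S → A // Measurable g}, M.utility (stationary M.horizon g) θ

/-- Regret of a policy. -/
def regret (π : Policy S A Y M.horizon) (θ : O) : ℝ := M.optimalUtility θ - M.utility π θ

/-- Minimax regret: infimum over laws on policies of the supremum over parameters of the expected
regret. -/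
def minimaxRegret [MeasurableSpace (Policy S A Y M.horizon)] : EReal :=
  ⨅ Q : ProbabilityMeasure (Policy S A Y M.horizon), ⨆ θ : O,
    ((∫ π, M.regret π θ ∂(Q : Measure (Policy S A Y M.horizon)) : ℝ) : EReal)

/-- The map `f (·, θ)`. -/
def slice (f : {f : S × O → A // Measurable f}) (θ : O) : {g : S → A // Measurable g} :=
  ⟨fun s => f.1 (s, θ), f.2.comp (by fun_prop)⟩

/-- `f` maximises the expected utility `E [∑ t, r (Y_t, f (S_t, Θ))]` under the prior `P`: its
rewards are integrable, and no map `S × O → A` does better. As in the definition of the optimal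
utility, a competitor may be chosen separately for each parameter; it is only required that
its expected utility exists. -/
structure IsOptimal (P : Measure O) [IsProbabilityMeasure P]
    (f : {f : S × O → A // Measurable f}) : Prop where
  integrable : ∀ t : Fin M.horizon,
    Integrable (fun x => M.stageReward x.2) (P.compProd (M.stageLaw (paramRule f) t))
  le : ∀ g : O → {g : S → A // Measurable g},
    Integrable (fun θ => M.utility (stationary M.horizon (g θ)) θ) P →
    ∫ θ, M.utility (stationary M.horizon (g θ)) θ ∂P ≤
      ∫ θ, M.utility (stationary M.horizon (slice f θ)) θ ∂P

/-- Law of `(Y_t^*, S_t^*)` given the parameter, when `f` is followed. -/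
def starLaw (f : {f : S × O → A // Measurable f}) (t : ℕ) : Kernel O (Y × S) :=
  (M.stageLaw (paramRule f) t).map fun x => (x.2, x.1.1.2)

section Thompson

variable [StandardBorelSpace O] [Nonempty O] (P : Measure O) [IsProbabilityMeasure P]
  (f : {f : S × O → A // Measurable f})

/-- Conditional law of the Thompson sampling action at time `t`, where `K` is the law of
(history, state) given the parameter: draw a parameter from its posterior given the history, and
apply `f` to the current state and the parameter drawn. -/
def thompsonRule {t : ℕ} (K : Kernel O (Hist S A Y t × S)) [IsMarkovKernel K] :
    Kernel (O × (Hist S A Y t × S)) A :=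
  (((posterior K.fst P).comap (fun x : O × (Hist S A Y t × S) => x.2.1) (by fun_prop)).prod
    (Kernel.deterministic (fun x : O × (Hist S A Y t × S) => x.2.2) (by fun_prop))).map
      fun z => f.1 (z.2, z.1)

instance {t : ℕ} (K : Kernel O (Hist S A Y t × S)) [IsMarkovKernel K] :
    IsMarkovKernel (thompsonRule P f K) :=
  Kernel.IsMarkovKernel.map _ (f.2.comp (by fun_prop))

/-- For each parameter, the law of (history, state) at time `t` under Thompson sampling with prior
`P`, together with the fact that it is a Markov kernel. -/
def thompsonAux : (t : ℕ) → {K : Kernel O (Hist S A Y t × S) // IsMarkovKernel K}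
  | 0 => ⟨M.start, inferInstance⟩
  | t + 1 =>
    have := (thompsonAux t).2
    ⟨M.nextStep (thompsonAux t).1 (thompsonRule P f (thompsonAux t).1),
      M.isMarkovKernel_nextStep _ _⟩

/-- For each parameter, the law of (history, state) at time `t` under Thompson sampling. -/
def thompsonLaw (t : ℕ) : Kernel O (Hist S A Y t × S) := (M.thompsonAux P f t).1

instance (t : ℕ) : IsMarkovKernel (M.thompsonLaw P f t) := (M.thompsonAux P f t).2

/-- Joint law of the parameter and (history, state, action, outcome) at time `t` under Thompson
sampling. -/
def thompsonJoint (t : ℕ) : Measure (O × (((Hist S A Y t × S) × A) × Y)) :=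
  P.compProd (M.actStep (M.thompsonLaw P f t) (thompsonRule P f (M.thompsonLaw P f t)))

instance (t : ℕ) : IsProbabilityMeasure (M.thompsonJoint P f t) := by
  have := M.isMarkovKernel_actStep (M.thompsonLaw P f t)
    (thompsonRule P f (M.thompsonLaw P f t))
  unfold thompsonJoint
  infer_instance

/-- Joint law of the parameter and the Thompson sampling history at time `t`. -/
def thompsonHist (t : ℕ) : Measure (O × Hist S A Y t) :=
  (M.thompsonJoint P f t).map fun x => (x.1, x.2.1.1.1)

/-- Conditional law of outcome and state at time `t` given the history, under Thompson
sampling. -/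
def predictive [StandardBorelSpace Y] [Nonempty Y] [StandardBorelSpace S] [Nonempty S] (t : ℕ) :
    Kernel (Hist S A Y t) (Y × S) :=
  condDistrib (fun x => (x.2.2, x.2.1.1.2)) (fun x => x.2.1.1.1) (M.thompsonJoint P f t)

end Thompson

/-- `X` is `c`-sub-Gaussian under the probability measure `μ`:
`E [exp (u (X - E X))] ≤ exp (c u² / 2)` for all real `u`. -/
def IsSubGaussian {Ω : Type*} [MeasurableSpace Ω] (X : Ω → ℝ) (c : ℝ≥0) (μ : Measure Ω) : Prop :=
  HasSubgaussianMGF (fun ω => X ω - ∫ ω', X ω' ∂μ) c μ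

end MDPClass

end

/-! It suffices to find, for each prior, one policy whose Bayesian regret is at most the right-hand
side for that prior. This is minimax duality (`exists_mixture_lt`), proved by Hahn–Banach. If no
mixture of policies had expected regret below `c` at every parameter, the convex set of continuous
regret functions of mixtures could be separated from the open convex set of continuous functions
below `c`. The separating functional is positive, hence by Riesz a positive multiple of a prior, and
under this prior no policy would have Bayesian regret below `c`.

For a fixed prior the policy comes from Thompson sampling. Given the history, the parameter drawn
has the posterior law of the true one and is independent of the current outcome and state. Hence
(`map_outcomeAction_thompsonSampling`) the expected reward at time `t` is that of playing `f (s, θ)`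
with the true `θ`, but with `(y, s)` drawn from its predictive law given the history only. The
optimal expected reward integrates the same function `r (y, f (s, θ))` against the law of `(Y*, S*)`
given `θ`. So the gap of a stage is the difference of the integrals of one function under two laws:
Donsker–Varadhan bounds it in the sub-Gaussian case, a coupling in the Lipschitz case.

Two discrepancies remain. Thompson sampling is randomised: its choices are realised by independent
noise, and one time after another the noise is frozen at a value that does at least as well as the
average (`exists_policy_integral_le`). And `U*` is a supremum for each parameter, whereas `f`
maximises an average: near-maximisers are selected measurably in the parameter
(`IsOptimal.integral_optimalUtility_le`). -/

open MeasureTheory ProbabilityTheory InformationTheory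
open scoped ENNReal NNReal

noncomputable section

/-! ### Minimax duality -/

/-- A positive linear functional on the continuous functions of a compact space that does not vanish
at `1` is a positive multiple of the expectation under a probability measure. -/
theorem exists_probabilityMeasure_of_positive {O : Type*} [TopologicalSpace O] [CompactSpace O]
    [T2Space O] [MeasurableSpace O] [BorelSpace O] (Λ : C(O, ℝ) →ₗ[ℝ] ℝ)
    (hΛ : ∀ g : C(O, ℝ), 0 ≤ g → 0 ≤ Λ g) (h1 : 0 < Λ 1) :
    ∃ P : ProbabilityMeasure O, ∀ g : C(O, ℝ), Λ g = Λ 1 * ∫ x, g x ∂(P : Measure O) := by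
  let Λ' : CompactlySupportedContinuousMap O ℝ →ₚ[ℝ] ℝ :=
    PositiveLinearMap.mk₀
      { toFun := fun g => Λ g.toContinuousMap
        map_add' := fun a b => by rw [← map_add]; rfl
        map_smul' := fun a b => by rw [← map_smul]; rfl }
      (fun g hg => hΛ _ hg)
  let m := RealRMK.rieszMeasure Λ'
  have hm (g : C(O, ℝ)) : ∫ x, g x ∂m = Λ g := by
    exact RealRMK.integral_rieszMeasure Λ' ⟨g, HasCompactSupport.of_compactSpace _⟩
  have hm1 : m.real Set.univ = Λ 1 := by
    have := hm 1
    simpa using this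
  have hfin : IsFiniteMeasure m := by
    refine ⟨lt_top_iff_ne_top.2 fun h => ?_⟩
    -- An infinite total mass would have real value 0, against `0 < Λ 1`.
    simp [Measure.real, h] at hm1
    exact h1.ne hm1
  have hne : NeZero m := ⟨fun h => by simp [h] at hm1; exact h1.ne hm1⟩
  refine ⟨⟨(m Set.univ)⁻¹ • m, inferInstance⟩, fun g => ?_⟩
  have : (m Set.univ)⁻¹.toReal = (Λ 1)⁻¹ := by
    rw [ENNReal.toReal_inv, ← hm1, Measure.real]
  simp only [ProbabilityMeasure.coe_mk, integral_smul_measure, hm, this, smul_eq_mul]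
  rw [mul_inv_cancel_left₀ h1.ne']

/-- Minimax duality for a bounded family of functions that are continuous on a compact space: if
every prior admits a policy with expected value below `c`, then some mixture of policies has
value below `c` everywhere. -/
theorem exists_mixture_lt {Pol O : Type*} [MeasurableSpace Pol] [Nonempty Pol]
    [TopologicalSpace O] [CompactSpace O] [T2Space O] [MeasurableSpace O] [BorelSpace O]
    (R : Pol → O → ℝ) (hmeas : ∀ θ, Measurable fun π => R π θ)
    (hbdd : ∃ C : ℝ, ∀ π θ, |R π θ| ≤ C) (hcont : ∀ π, Continuous (R π)) (c : ℝ)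
    (h : ∀ P : ProbabilityMeasure O, ∃ π, ∫ θ, R π θ ∂(P : Measure O) < c) :
    ∃ Q : ProbabilityMeasure Pol, ∀ θ, ∫ π, R π θ ∂(Q : Measure Pol) < c := by
  by_contra! hQ
  obtain ⟨C, hC⟩ := hbdd
  have hi (μ : Measure Pol) [IsFiniteMeasure μ] (θ : O) : Integrable (fun π => R π θ) μ :=
    .of_bound (hmeas θ).aestronglyMeasurable C (.of_forall fun π => hC π θ)
  -- `K` contains only those mixtures whose expected value is continuous in the parameter.
  -- Continuity for general mixtures is not needed, since the Dirac masses already lie in `K`.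
  let K : Set C(O, ℝ) :=
    {g | ∃ Q : ProbabilityMeasure Pol, ∀ θ, g θ = ∫ π, R π θ ∂(Q : Measure Pol)}
  let V : Set C(O, ℝ) := {g | ∀ θ, g θ < c}
  have hK : Convex ℝ K := by
    rintro g₁ ⟨Q₁, h₁⟩ g₂ ⟨Q₂, h₂⟩ a b ha hb hab
    refine ⟨⟨ENNReal.ofReal a • (Q₁ : Measure Pol) + ENNReal.ofReal b • (Q₂ : Measure Pol), ⟨?_⟩⟩,
      fun θ => ?_⟩
    · simp [← ENNReal.ofReal_add ha hb, hab]
    · have e₁ : Integrable (fun π => R π θ) (ENNReal.ofReal a • (Q₁ : Measure Pol)) :=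
        (hi _ θ).smul_measure ENNReal.ofReal_ne_top
      have e₂ : Integrable (fun π => R π θ) (ENNReal.ofReal b • (Q₂ : Measure Pol)) :=
        (hi _ θ).smul_measure ENNReal.ofReal_ne_top
      simp only [ProbabilityMeasure.coe_mk]
      rw [integral_add_measure e₁ e₂]
      simp [h₁, h₂, ENNReal.toReal_ofReal ha, ENNReal.toReal_ofReal hb]
  have hRK (π : Pol) : (⟨R π, hcont π⟩ : C(O, ℝ)) ∈ K := by
    refine ⟨⟨Measure.dirac π, inferInstance⟩, fun θ => ?_⟩
    simp only [ProbabilityMeasure.coe_mk]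
    rw [integral_dirac' _ _ (hmeas θ).stronglyMeasurable]
    rfl
  have hV : Convex ℝ V := by
    intro g₁ h₁ g₂ h₂ a b ha hb hab θ
    exact (convex_Iio c) (h₁ θ) (h₂ θ) ha hb hab
  have hVo : IsOpen V := by
    have := ContinuousMap.isOpen_setOfPred_mapsTo (X := O) isCompact_univ (isOpen_Iio (a := c))
    simpa [Set.MapsTo, V] using this
  have hdisj : Disjoint V K := by
    refine Set.disjoint_left.2 fun g hg ⟨Q, hgQ⟩ => ?_
    obtain ⟨θ, hθ⟩ := hQ Q
    exact absurd (hg θ) (by rw [hgQ θ]; exact hθ.not_gt)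
  obtain ⟨Λ, u, hΛV, hΛK⟩ := geometric_hahn_banach_open hV hVo hK hdisj
  -- `V` is stable under subtracting multiples `n • g` of a nonnegative `g`, and `Λ` is bounded
  -- above by `u` on `V`. A negative `Λ g` would violate this bound for large `n`.
  have hpos (g : C(O, ℝ)) (hg : 0 ≤ g) : 0 ≤ Λ g := by
    by_contra! hneg
    obtain ⟨n, hn⟩ := exists_nat_gt ((u - Λ (ContinuousMap.const O (c - 1))) / (-Λ g))
    have hmem : ContinuousMap.const O (c - 1) - (n : ℝ) • g ∈ V := by
      intro θ
      have : 0 ≤ (n : ℝ) * g θ := mul_nonneg n.cast_nonneg (hg θ)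
      simp only [ContinuousMap.sub_apply, ContinuousMap.const_apply, ContinuousMap.smul_apply,
        smul_eq_mul]
      linarith
    have := hΛV _ hmem
    rw [div_lt_iff₀ (by linarith)] at hn
    simp only [map_sub, map_smul, smul_eq_mul] at this
    linarith
  have hconst (x : ℝ) : Λ (ContinuousMap.const O x) = x * Λ 1 := by
    rw [← smul_eq_mul, ← map_smul]
    congr 1
    ext θ
    simp
  -- If `Λ 1 = 0`, then `Λ` vanishes on constants. A constant in `V` gives `0 < u`, while `R π ≤ C`
  -- and positivity give `u ≤ Λ (R π) ≤ 0`.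
  have h1 : 0 < Λ 1 := by
    refine lt_of_le_of_ne (hpos 1 fun θ => zero_le_one) fun h0 => ?_
    obtain ⟨π⟩ := ‹Nonempty Pol›
    set g : C(O, ℝ) := ⟨R π, hcont π⟩
    have hle : 0 ≤ Λ (ContinuousMap.const O C - g) := hpos _ fun θ => by
      simpa [g] using (abs_le.1 (hC π θ)).2
    have h2 := hΛK g (hRK π)
    have h3 := hΛV (ContinuousMap.const O (c - 1)) fun θ => by simp
    simp only [map_sub, hconst, ← h0, mul_zero] at hle h3
    linarith
  obtain ⟨P, hP⟩ := exists_probabilityMeasure_of_positive (Λ : C(O, ℝ) →ₗ[ℝ] ℝ) hpos h1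
  obtain ⟨π, hπ⟩ := h P
  have h2 := hΛK _ (hRK π)
  have h3 : Λ ⟨R π, hcont π⟩ = Λ 1 * ∫ θ, R π θ ∂(P : Measure O) := hP ⟨R π, hcont π⟩
  have h4 : c * Λ 1 ≤ u := by
    refine le_of_forall_pos_le_add fun ε hε => ?_
    have := hΛV (ContinuousMap.const O (c - ε / Λ 1)) fun θ => by simp; positivity
    rw [hconst, sub_mul, div_mul_cancel₀ _ h1.ne'] at this
    linarith
  have := mul_lt_mul_of_pos_left hπ h1
  linarith

/-- Minimax duality: a bound for the Bayesian regret under every prior bounds the minimax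
regret. -/
theorem MDPClass.minimaxRegret_le_of_forall_prior {S A Y O : Type*} [MeasurableSpace S]
    [MeasurableSpace A] [MeasurableSpace Y] [MetricSpace O] [CompactSpace O] [MeasurableSpace O]
    [BorelSpace O] (M : MDPClass S A Y O) [MeasurableSpace (Policy S A Y M.horizon)]
    [Nonempty (Policy S A Y M.horizon)] (hmeas : ∀ θ, Measurable fun π => M.regret π θ)
    (hbdd : ∃ C : ℝ, ∀ π θ, |M.regret π θ| ≤ C) (hcont : ∀ π, Continuous fun θ => M.regret π θ)
    (c : ℝ) (h : ∀ P : ProbabilityMeasure O, ∃ π, ∫ θ, M.regret π θ ∂(P : Measure O) ≤ c) :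
    M.minimaxRegret ≤ (c : EReal) := by
  refine EReal.le_of_forall_lt_iff_le.1 fun z hz => ?_
  obtain ⟨Q, hQ⟩ := exists_mixture_lt M.regret hmeas hbdd hcont z fun P =>
    (h P).imp fun π hπ => hπ.trans_lt (EReal.coe_lt_coe_iff.1 hz)
  exact (iInf_le _ Q).trans (iSup_le fun θ => EReal.coe_le_coe_iff.2 (hQ θ).le)

/-! ### Change of measure for sub-Gaussian variables -/

/-- One half of the Donsker–Varadhan variational formula for the Kullback–Leibler divergence. -/
theorem integral_le_toReal_klDiv_add_log {Ω : Type*} [MeasurableSpace Ω] {μ ν : Measure Ω}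
    [IsProbabilityMeasure μ] [IsProbabilityMeasure ν] {X : Ω → ℝ} (hX : Integrable X μ)
    (hexp : Integrable (fun ω => Real.exp (X ω)) ν) (hkl : klDiv μ ν ≠ ∞) :
    ∫ ω, X ω ∂μ ≤ (klDiv μ ν).toReal + Real.log (∫ ω, Real.exp (X ω) ∂ν) := by
  obtain ⟨hac, hllr⟩ := klDiv_ne_top_iff.1 hkl
  have := isProbabilityMeasure_tilted hexp
  have hac' : μ ≪ ν.tilted X := hac.trans (absolutelyContinuous_tilted hexp)
  -- The inequality is nonnegativity of the divergence of `μ` from the exponentially tilted measure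
  -- `ν.tilted X`, whose log-likelihood ratio splits into three terms.
  have h0 := integral_llr_add_sub_measure_univ_nonneg hac'
    (integrable_llr_tilted_right hac hX hllr hexp)
  rw [integral_llr_tilted_right hac hX hexp hllr] at h0
  rw [toReal_klDiv_of_measure_eq hac (by simp)]
  simp only [probReal_univ] at h0
  linarith

namespace MDPClass.IsSubGaussian

variable {Ω : Type*} [MeasurableSpace Ω] {μ ν : Measure Ω} [IsProbabilityMeasure μ]
  [IsProbabilityMeasure ν] {X : Ω → ℝ}

/-- The centring constant would be 0 by convention if `X` were not integrable, but the exponential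
moments of the centred variable exclude that case. -/
theorem integrable {c : ℝ≥0} (h : MDPClass.IsSubGaussian X c ν) : Integrable X ν := by
  have h1 : Integrable (fun ω => X ω - ∫ ω', X ω' ∂ν) ν := HasSubgaussianMGF.integrable h
  simpa [Function.comp_def] using (h1.add (integrable_const (∫ ω', X ω' ∂ν))).congr
    (.of_forall fun ω => sub_add_cancel (X ω) _)

/-- From `|x| ≤ exp x + exp (-x)` and the moment bounds at `u = 1` and `u = -1`. Only finiteness of
the constant matters later. -/
theorem integral_abs_sub_le {c : ℝ≥0} (h : MDPClass.IsSubGaussian X c ν) :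
    ∫ ω, |X ω - ∫ ω', X ω' ∂ν| ∂ν ≤ 2 * Real.exp (c / 2) := by
  have hp := h.integrable_exp_mul 1
  have hn := h.integrable_exp_mul (-1)
  have bp := h.mgf_le 1
  have bn := h.mgf_le (-1)
  simp only [mgf] at bp bn
  calc ∫ ω, |X ω - ∫ ω', X ω' ∂ν| ∂ν
      ≤ ∫ ω, (Real.exp (1 * (X ω - ∫ ω', X ω' ∂ν)) +
          Real.exp (-1 * (X ω - ∫ ω', X ω' ∂ν))) ∂ν := by
        refine integral_mono (h.integrable.sub (integrable_const _)).abs (hp.add hn) fun ω => ?_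
        simp only [one_mul, neg_one_mul]
        rcases abs_cases (X ω - ∫ ω', X ω' ∂ν) with ⟨e, -⟩ | ⟨e, -⟩ <;> rw [e]
        · linarith [Real.add_one_le_exp (X ω - ∫ ω', X ω' ∂ν),
            Real.exp_pos (-(X ω - ∫ ω', X ω' ∂ν))]
        · linarith [Real.add_one_le_exp (-(X ω - ∫ ω', X ω' ∂ν)),
            Real.exp_pos (X ω - ∫ ω', X ω' ∂ν)]
    _ ≤ 2 * Real.exp (c / 2) := by
        rw [integral_add hp hn]
        norm_num at bp bn ⊢
        linarith

/-- The transportation inequality for sub-Gaussian variables. -/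
theorem sq_integral_sub_le {c : ℝ≥0} (h : MDPClass.IsSubGaussian X c ν) (hc : 0 < c)
    (hX : Integrable X μ) (hkl : klDiv μ ν ≠ ∞) :
    (∫ ω, X ω ∂μ - ∫ ω, X ω ∂ν) ^ 2 ≤ 2 * c * (klDiv μ ν).toReal := by
  set m := ∫ ω, X ω ∂ν with hm
  set d := ∫ ω, X ω ∂μ - m with hd
  have hc' : (0 : ℝ) < c := hc
  -- The multiplier `d / c` maximises `u * d - c * u ^ 2 / 2`; the maximum is `d ^ 2 / (2 * c)`.
  have h1 := integral_le_toReal_klDiv_add_log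
    ((hX.sub (integrable_const m)).const_mul (d / c)) (h.integrable_exp_mul (d / c)) hkl
  have h2 : ∫ ω, d / c * (X ω - m) ∂μ = d / c * d := by
    rw [integral_const_mul, integral_sub hX (integrable_const m)]
    simp [hd]
  have h3 : Real.log (∫ ω, Real.exp (d / c * (X ω - m)) ∂ν) ≤ c * (d / c) ^ 2 / 2 := by
    refine (Real.log_le_iff_le_exp ?_).2 (h.mgf_le (d / c))
    exact integral_exp_pos (h.integrable_exp_mul (d / c))
  simp only [Pi.sub_apply] at h1
  rw [h2] at h1
  have h4 : d / c * d - c * (d / c) ^ 2 / 2 ≤ (klDiv μ ν).toReal := by linarith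
  have h5 : d / c * d - c * (d / c) ^ 2 / 2 = d ^ 2 / (2 * c) := by field_simp; ring
  rw [h5, div_le_iff₀ (by positivity)] at h4
  linarith

theorem ofReal_abs_integral_sub_le {σ : ℝ≥0} (h : MDPClass.IsSubGaussian X (σ ^ 2) ν) (hσ : 0 < σ)
    (hX : Integrable X μ) :
    ENNReal.ofReal |∫ ω, X ω ∂μ - ∫ ω, X ω ∂ν| ≤
      (2 * (σ : ℝ≥0∞) ^ 2 * klDiv μ ν) ^ (1 / 2 : ℝ) := by
  by_cases hkl : klDiv μ ν = ∞
  · rw [hkl, ENNReal.mul_top (by simp [hσ.ne']), ENNReal.top_rpow_of_pos (by norm_num)]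
    exact le_top
  have h1 := h.sq_integral_sub_le (by positivity) hX hkl
  rw [← ENNReal.ofReal_toReal hkl]
  have e : 2 * (σ : ℝ≥0∞) ^ 2 = ENNReal.ofReal (2 * (σ : ℝ) ^ 2) := by
    rw [ENNReal.ofReal_mul (by norm_num), ENNReal.ofReal_pow (by positivity)]
    simp
  rw [e, ← ENNReal.ofReal_mul (by positivity), ENNReal.ofReal_rpow_of_nonneg (by positivity)
    (by norm_num), ← Real.sqrt_eq_rpow]
  refine ENNReal.ofReal_le_ofReal (Real.abs_le_sqrt ?_)
  simpa using h1

/-- The triangle inequality through the two means. It carries integrability of the reward from the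
optimal law `μ` over to the prediction `ν`, in a form that can be integrated over parameter and
history. -/
theorem lintegral_enorm_le {σ : ℝ≥0} (h : MDPClass.IsSubGaussian X (σ ^ 2) ν) (hσ : 0 < σ)
    (hX : Integrable X μ) :
    ∫⁻ ω, ‖X ω‖ₑ ∂ν ≤ ∫⁻ ω, ‖X ω‖ₑ ∂μ + (2 * (σ : ℝ≥0∞) ^ 2 * klDiv μ ν) ^ (1 / 2 : ℝ) +
      ENNReal.ofReal (2 * Real.exp ((σ ^ 2 : ℝ≥0) / 2)) := by
  have h1 := h.ofReal_abs_integral_sub_le hσ hX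
  have h2 := h.integral_abs_sub_le
  have h3 := h.integrable
  refine le_trans ?_ (add_le_add (add_le_add_right h1 _) (ENNReal.ofReal_le_ofReal h2))
  rw [← ofReal_integral_norm_eq_lintegral_enorm h3, ← ofReal_integral_norm_eq_lintegral_enorm hX,
    ← ENNReal.ofReal_add (integral_nonneg fun _ => norm_nonneg _) (abs_nonneg _),
    ← ENNReal.ofReal_add (add_nonneg (integral_nonneg fun _ => norm_nonneg _) (abs_nonneg _))
      (integral_nonneg fun _ => abs_nonneg _)]
  refine ENNReal.ofReal_le_ofReal ?_
  set m := ∫ ω, X ω ∂ν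
  have h4 : ∫ ω, ‖X ω‖ ∂ν ≤ ∫ ω, (|X ω - m| + |m|) ∂ν := by
    refine integral_mono h3.norm ((h3.sub (integrable_const m)).abs.add (integrable_const _))
      fun ω => ?_
    simpa using abs_add_le (X ω - m) m
  have hi : Integrable (fun ω => |X ω - m|) ν := (h3.sub (integrable_const m)).abs
  rw [integral_add hi (integrable_const _)] at h4
  have h5 : |m| ≤ |∫ ω, X ω ∂μ| + |∫ ω, X ω ∂μ - m| := by
    have := abs_sub (∫ ω, X ω ∂μ) (∫ ω, X ω ∂μ - m)
    simpa using this
  have h6 : |∫ ω, X ω ∂μ| ≤ ∫ ω, ‖X ω‖ ∂μ := abs_integral_le_integral_abs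
  simp only [integral_const, probReal_univ, one_smul] at h4
  linarith

end MDPClass.IsSubGaussian

/-! ### Change of measure by couplings -/

section Transport

variable {Z : Type*} [MeasurableSpace Z] {c : Z → Z → ℝ≥0∞} {P Q : Measure Z}

/-- Bounding by a multiple of the transport cost amounts to bounding by the multiple of the cost of
every coupling. -/
theorem le_mul_transportCost [IsProbabilityMeasure P] [IsProbabilityMeasure Q] {L : ℝ≥0}
    {a b : ℝ≥0∞}
    (h : ∀ D : Measure (Z × Z), D.fst = P → D.snd = Q → a ≤ b + L * ∫⁻ z, c z.1 z.2 ∂D) :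
    a ≤ b + L * transportCost c P Q := by
  -- For `L = 0` the bound must hold without the cost even if the infimum is infinite; the product
  -- coupling gives it.
  rcases eq_or_ne L 0 with rfl | hL
  · simpa using h (P.prod Q) (by simp) (by simp)
  · have hL' : (L : ℝ≥0∞) ≠ 0 := by simpa using hL
    rw [transportCost, ENNReal.mul_iInf_of_ne hL' ENNReal.coe_ne_top, ENNReal.add_iInf]
    refine le_iInf fun D => ?_
    rw [ENNReal.mul_iInf_of_ne hL' ENNReal.coe_ne_top, ENNReal.add_iInf]
    exact le_iInf fun hD => h D hD.1 hD.2

/-- The Lipschitz counterpart of `MDPClass.IsSubGaussian.lintegral_enorm_le`: under a coupling, `|r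
z'|` exceeds `|r z|` by at most `L` times the cost. -/
theorem lintegral_enorm_le_add_transportCost [IsProbabilityMeasure P] [IsProbabilityMeasure Q]
    {L : ℝ≥0} {r : Z → ℝ} (hr : Measurable r)
    (hL : ∀ z z', edist (r z) (r z') ≤ L * c z z') :
    ∫⁻ z, ‖r z‖ₑ ∂Q ≤ ∫⁻ z, ‖r z‖ₑ ∂P + L * transportCost c P Q := by
  refine le_mul_transportCost fun D hP hQ => ?_
  subst hP hQ
  rw [Measure.fst, Measure.snd, lintegral_map hr.enorm measurable_fst,
    lintegral_map hr.enorm measurable_snd, ← lintegral_const_mul' _ _ ENNReal.coe_ne_top,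
    ← lintegral_add_left (by fun_prop)]
  refine lintegral_mono fun z => ?_
  calc ‖r z.2‖ₑ = ‖r z.1 - (r z.1 - r z.2)‖ₑ := by rw [sub_sub_cancel]
    _ ≤ ‖r z.1‖ₑ + ‖r z.1 - r z.2‖ₑ := enorm_sub_le
    _ ≤ _ := by rw [← edist_eq_enorm_sub]; gcongr; exact hL _ _

theorem ofReal_integral_sub_le_transportCost [IsProbabilityMeasure P] [IsProbabilityMeasure Q]
    {L : ℝ≥0} {r : Z → ℝ} (hL : ∀ z z', edist (r z) (r z') ≤ L * c z z')
    (hP : Integrable r P) (hQ : Integrable r Q) :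
    ENNReal.ofReal (∫ z, r z ∂P - ∫ z, r z ∂Q) ≤ L * transportCost c P Q := by
  suffices h : ENNReal.ofReal (∫ z, r z ∂P - ∫ z, r z ∂Q) ≤ 0 + L * transportCost c P Q by
    simpa using h
  refine le_mul_transportCost fun D h₁ h₂ => ?_
  subst h₁ h₂
  rw [Measure.fst] at hP
  rw [Measure.snd] at hQ
  rw [Measure.fst, Measure.snd, integral_map measurable_fst.aemeasurable hP.1,
    integral_map measurable_snd.aemeasurable hQ.1,
    ← integral_sub (by exact hP.comp_measurable measurable_fst)
      (by exact hQ.comp_measurable measurable_snd), ← lintegral_const_mul' _ _ ENNReal.coe_ne_top,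
    zero_add]
  refine (ENNReal.ofReal_le_ofReal (le_abs_self _)).trans ?_
  rw [← Real.enorm_eq_ofReal_abs]
  refine (enorm_integral_le_lintegral_enorm _).trans (lintegral_mono fun z => ?_)
  rw [← edist_eq_enorm_sub]
  exact hL _ _

end Transport

/-! ### Stage laws as iterated integrals -/

namespace MDPClass

variable {S A Y O O' : Type*} [MeasurableSpace S] [MeasurableSpace A] [MeasurableSpace Y]
  [MeasurableSpace O] [MeasurableSpace O'] (M : MDPClass S A Y O) {t : ℕ}

theorem measurable_stageReward : Measurable (M.stageReward (t := t)) :=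
  M.measurable_reward.comp (by fun_prop)

/-- A policy used as a rule is the zero kernel past the horizon, hence not Markov; s-finiteness is
what the laws of all rules in use share. -/
instance isSFiniteKernel_actStep (K : Kernel O (Hist S A Y t × S))
    (D : Kernel (O × (Hist S A Y t × S)) A) [IsSFiniteKernel K] [IsSFiniteKernel D] :
    IsSFiniteKernel (M.actStep K D) := by
  have := M.markov_out
  unfold actStep
  infer_instance

instance isSFiniteKernel_nextStep (K : Kernel O (Hist S A Y t × S))
    (D : Kernel (O × (Hist S A Y t × S)) A) [IsSFiniteKernel K] [IsSFiniteKernel D] :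
    IsSFiniteKernel (M.nextStep K D) := by
  have := M.markov_trans
  unfold nextStep
  infer_instance

instance isSFiniteKernel_stateLaw (D : Rule S A Y O) [∀ t, IsSFiniteKernel (D t)] (t : ℕ) :
    IsSFiniteKernel (M.stateLaw D t) := by
  induction t with
  | zero => exact inferInstanceAs (IsSFiniteKernel M.start)
  | succ t ih => exact inferInstanceAs (IsSFiniteKernel (M.nextStep (M.stateLaw D t) (D t)))

instance isMarkovKernel_stateLaw (D : Rule S A Y O) [∀ t, IsMarkovKernel (D t)] (t : ℕ) :
    IsMarkovKernel (M.stateLaw D t) := by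
  induction t with
  | zero => exact inferInstanceAs (IsMarkovKernel M.start)
  | succ t ih => exact M.isMarkovKernel_nextStep (M.stateLaw D t) (D t)

instance isMarkovKernel_stageLaw (D : Rule S A Y O) [∀ t, IsMarkovKernel (D t)] (t : ℕ) :
    IsMarkovKernel (M.stageLaw D t) :=
  M.isMarkovKernel_actStep _ _

instance isSFiniteKernel_stageLaw (D : Rule S A Y O) [∀ t, IsSFiniteKernel (D t)] (t : ℕ) :
    IsSFiniteKernel (M.stageLaw D t) :=
  M.isSFiniteKernel_actStep _ _

theorem lintegral_actStep (K : Kernel O (Hist S A Y t × S))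
    (D : Kernel (O × (Hist S A Y t × S)) A) [IsSFiniteKernel K] [IsSFiniteKernel D] (θ : O)
    {g : ((Hist S A Y t × S) × A) × Y → ℝ≥0∞} (hg : Measurable g) :
    ∫⁻ z, g z ∂(M.actStep K D θ) =
      ∫⁻ x, ∫⁻ a, ∫⁻ y, g ((x, a), y) ∂M.out (x.2, θ) ∂D (θ, x) ∂K θ := by
  have := M.markov_out
  rw [actStep, Kernel.lintegral_compProd _ _ _ hg, Kernel.lintegral_compProd]
  · rfl
  · exact hg.lintegral_kernel_prod_right' (κ := (M.out.comap
      (fun x : O × ((Hist S A Y t × S) × A) => (x.2.1.2, x.1)) (by fun_prop)).sectR θ)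

theorem lintegral_nextStep (K : Kernel O (Hist S A Y t × S))
    (D : Kernel (O × (Hist S A Y t × S)) A) [IsSFiniteKernel K] [IsSFiniteKernel D] (θ : O)
    {g : Hist S A Y (t + 1) × S → ℝ≥0∞} (hg : Measurable g) :
    ∫⁻ z, g z ∂(M.nextStep K D θ) =
      ∫⁻ w, ∫⁻ s, g (extend t (w, s)) ∂M.trans (w.1.1.2, w.1.2, θ) ∂M.actStep K D θ := by
  have := M.markov_trans
  rw [nextStep, Kernel.map_apply _ (measurable_extend t), lintegral_map hg (measurable_extend t),
    Kernel.lintegral_compProd _ _ _ (f := fun w => g (extend t w))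
      (hg.comp (measurable_extend t))]
  rfl

theorem measurable_lintegral_trans (θ : O) {g : Hist S A Y (t + 1) × S → ℝ≥0∞}
    (hg : Measurable g) :
    Measurable fun w : ((Hist S A Y t × S) × A) × Y =>
      ∫⁻ s, g (extend t (w, s)) ∂M.trans (w.1.1.2, w.1.2, θ) := by
  have := M.markov_trans
  exact (hg.comp (measurable_extend t)).lintegral_kernel_prod_right' (κ := M.trans.comap
    (fun w : ((Hist S A Y t × S) × A) × Y => (w.1.1.2, w.1.2, θ)) (by fun_prop))

theorem measurable_lintegral_out (θ : O) {g : ((Hist S A Y t × S) × A) × Y → ℝ≥0∞}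
    (hg : Measurable g) :
    Measurable fun x : (Hist S A Y t × S) × A => ∫⁻ y, g (x, y) ∂M.out (x.1.2, θ) := by
  have := M.markov_out
  exact hg.lintegral_kernel_prod_right' (κ := M.out.comap
    (fun x : (Hist S A Y t × S) × A => (x.1.2, θ)) (by fun_prop))

section Congr

variable {M} {M' : MDPClass S A Y O'} {θ : O} {θ' : O'}

theorem actStep_congr {K : Kernel O (Hist S A Y t × S)} {D : Kernel (O × (Hist S A Y t × S)) A}
    {K' : Kernel O' (Hist S A Y t × S)} {D' : Kernel (O' × (Hist S A Y t × S)) A}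
    [IsSFiniteKernel K] [IsSFiniteKernel D] [IsSFiniteKernel K'] [IsSFiniteKernel D']
    (hout : ∀ s, M.out (s, θ) = M'.out (s, θ')) (hK : K θ = K' θ')
    (hD : ∀ x, D (θ, x) = D' (θ', x)) : M.actStep K D θ = M'.actStep K' D' θ' := by
  refine Measure.ext_of_lintegral _ fun g hg => ?_
  rw [lintegral_actStep _ _ _ _ hg, lintegral_actStep _ _ _ _ hg]
  simp only [hout, hK, hD]

/-- The law at a fixed parameter sees the kernels at that parameter only, and the rule only at
earlier times. The parameter spaces may differ, so that a noise variable can be adjoined as a second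
parameter. -/
theorem stateLaw_congr {D : Rule S A Y O} {D' : Rule S A Y O'} [∀ t, IsSFiniteKernel (D t)]
    [∀ t, IsSFiniteKernel (D' t)] (hinit : M.init θ = M'.init θ')
    (htrans : ∀ s a, M.trans (s, a, θ) = M'.trans (s, a, θ'))
    (hout : ∀ s, M.out (s, θ) = M'.out (s, θ')) (t : ℕ)
    (hD : ∀ k < t, ∀ x, D k (θ, x) = D' k (θ', x)) : M.stateLaw D t θ = M'.stateLaw D' t θ' := by
  induction t with
  | zero =>
    simp only [stateLaw, start]
    rw [Kernel.map_apply _ (by fun_prop), Kernel.map_apply _ (by fun_prop), hinit]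
  | succ t ih =>
    have h := actStep_congr hout (ih fun k hk => hD k (hk.trans t.lt_succ_self))
      (hD t t.lt_succ_self)
    refine Measure.ext_of_lintegral _ fun g hg => ?_
    simp only [stateLaw]
    rw [lintegral_nextStep _ _ _ _ hg, lintegral_nextStep _ _ _ _ hg, h]
    simp only [htrans]

theorem stageLaw_congr {D : Rule S A Y O} {D' : Rule S A Y O'} [∀ t, IsSFiniteKernel (D t)]
    [∀ t, IsSFiniteKernel (D' t)] (hinit : M.init θ = M'.init θ')
    (htrans : ∀ s a, M.trans (s, a, θ) = M'.trans (s, a, θ'))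
    (hout : ∀ s, M.out (s, θ) = M'.out (s, θ')) (t : ℕ)
    (hD : ∀ k ≤ t, ∀ x, D k (θ, x) = D' k (θ', x)) : M.stageLaw D t θ = M'.stageLaw D' t θ' :=
  actStep_congr hout (stateLaw_congr hinit htrans hout t fun k hk => hD k hk.le) (hD t le_rfl)

end Congr

instance isSFiniteKernel_policyRule {T : ℕ} (π : Policy S A Y T) (t : ℕ) :
    IsSFiniteKernel (policyRule (O := O) π t) := by
  unfold policyRule
  split_ifs <;> infer_instance

instance isMarkovKernel_paramRule (f : {f : S × O → A // Measurable f}) (t : ℕ) :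
    IsMarkovKernel (paramRule (Y := Y) f t) := by
  unfold paramRule
  infer_instance

theorem policyRule_apply {T : ℕ} (π : Policy S A Y T) (ht : t < T)
    (p : O × (Hist S A Y t × S)) :
    policyRule π t p = Measure.dirac (π.1 ⟨t, ht⟩ p.2) := by
  simp only [policyRule, ht, dite_true]
  exact Kernel.deterministic_apply _ _

/-- For a known parameter, a rule that plays a function of state and parameter is a stationary
policy. -/
theorem stageLaw_stationary_slice (f : {f : S × O → A // Measurable f}) (θ : O)
    {T : ℕ} (ht : t < T) :
    M.stageLaw (policyRule (stationary T (slice f θ))) t θ = M.stageLaw (paramRule f) t θ := by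
  refine stageLaw_congr rfl (fun _ _ => rfl) (fun _ => rfl) t fun k hk x => ?_
  rw [policyRule_apply _ (hk.trans_lt ht), paramRule, Kernel.deterministic_apply]
  rfl

/-! ### Randomised actions as mixtures over noise -/

section Randomised

variable {U : Type*} [MeasurableSpace U]

/-- The same class of MDPs with an additional parameter that has no influence. -/
def addParam (U : Type*) [MeasurableSpace U] : MDPClass S A Y (O × U) where
  horizon := M.horizon
  init := M.init.comap Prod.fst measurable_fst
  trans := M.trans.comap (fun x => (x.1, x.2.1, x.2.2.1)) (by fun_prop)
  out := M.out.comap (fun x => (x.1, x.2.1)) (by fun_prop)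
  reward := M.reward
  markov_init := have := M.markov_init; inferInstance
  markov_trans := have := M.markov_trans; inferInstance
  markov_out := have := M.markov_out; inferInstance
  measurable_reward := M.measurable_reward

/-- The rule that follows `D`, except that at time `k` it plays `ψ`. -/
def playAt (D : Rule S A Y O) (k : ℕ) (ψ : Hist S A Y k × S → A) (hψ : Measurable ψ) :
    Rule S A Y O :=
  Function.update D k (Kernel.deterministic (fun p => ψ p.2) (hψ.comp measurable_snd))

theorem measurable_param_state {X : Type*} [MeasurableSpace X] {φ : X → U → A}
    (hφ : Measurable φ.uncurry) : Measurable fun p : (O × U) × X => φ p.2 p.1.2 :=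
  hφ.comp (measurable_snd.prodMk measurable_fst.snd)

/-- The rule that follows `D`, except that at time `k` it plays `φ`, which may use the additional
parameter. -/
def playParamAt (D : Rule S A Y O) (k : ℕ) (φ : Hist S A Y k × S → U → A)
    (hφ : Measurable φ.uncurry) : Rule S A Y (O × U) :=
  Function.update (fun t => (D t).comap (fun p => (p.1.1, p.2)) (by fun_prop)) k
    (Kernel.deterministic (fun p => φ p.2 p.1.2) (measurable_param_state hφ))

instance isMarkovKernel_playAt (D : Rule S A Y O) [∀ t, IsMarkovKernel (D t)] (k : ℕ)
    (ψ : Hist S A Y k × S → A) (hψ : Measurable ψ) (t : ℕ) :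
    IsMarkovKernel (playAt D k ψ hψ t) := by
  unfold playAt
  rcases eq_or_ne t k with rfl | h
  · rw [Function.update_self]; infer_instance
  · rw [Function.update_of_ne h]; infer_instance

variable (D : Rule S A Y O) (k : ℕ) (φ : Hist S A Y k × S → U → A) (hφ : Measurable φ.uncurry)

theorem playParamAt_self (p : (O × U) × (Hist S A Y k × S)) :
    playParamAt D k φ hφ k p = Measure.dirac (φ p.2 p.1.2) := by
  rw [playParamAt, Function.update_self, Kernel.deterministic_apply]

theorem playParamAt_of_ne (h : t ≠ k) (p : (O × U) × (Hist S A Y t × S)) :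
    playParamAt D k φ hφ t p = D t (p.1.1, p.2) := by
  rw [playParamAt, Function.update_of_ne h]
  rfl

variable [∀ t, IsMarkovKernel (D t)]

instance isMarkovKernel_playParamAt (t : ℕ) : IsMarkovKernel (playParamAt D k φ hφ t) := by
  unfold playParamAt
  rcases eq_or_ne t k with rfl | h
  · rw [Function.update_self]; infer_instance
  · rw [Function.update_of_ne h]; infer_instance

theorem addParam_stateLaw_congr {D' : Rule S A Y (O × U)} [∀ t, IsMarkovKernel (D' t)] {θ : O}
    {u : U} (t : ℕ) (hD : ∀ k < t, ∀ x, D' k ((θ, u), x) = D k (θ, x)) :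
    (M.addParam U).stateLaw D' t (θ, u) = M.stateLaw D t θ :=
  stateLaw_congr (M := M.addParam U) (M' := M) (θ := (θ, u)) (θ' := θ) rfl (fun _ _ => rfl)
    (fun _ => rfl) t hD

theorem stageLaw_playParamAt (t : ℕ) (θ : O) (u : U) :
    (M.addParam U).stageLaw (playParamAt D k φ hφ) t (θ, u) =
      M.stageLaw (playAt D k (fun x => φ x u) hφ.of_uncurry_right) t θ := by
  refine stageLaw_congr (M := M.addParam U) (M' := M) (θ := (θ, u)) (θ' := θ) rfl
    (fun _ _ => rfl) (fun _ => rfl) t fun j _ x => ?_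
  rcases eq_or_ne j k with rfl | h
  · rw [playParamAt_self, playAt, Function.update_self, Kernel.deterministic_apply]
  · rw [playParamAt_of_ne D k φ hφ h, playAt, Function.update_of_ne h]

variable {ν : Measure U} [IsProbabilityMeasure ν]

/-- The noise matters only at time `k`. There the state law does not depend on it and Tonelli
exchanges noise and state; at any other time the action kernel is free of noise and the mixture
identity for states passes through. -/
theorem lintegral_actStep_playParamAt (hD : ∀ p, ν.map (φ p.2) = D k p) (θ : O)
    (hstate : ∀ g : Hist S A Y t × S → ℝ≥0∞, Measurable g → ∫⁻ z, g z ∂M.stateLaw D t θ =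
      ∫⁻ u, ∫⁻ z, g z ∂(M.addParam U).stateLaw (playParamAt D k φ hφ) t (θ, u) ∂ν)
    {g : ((Hist S A Y t × S) × A) × Y → ℝ≥0∞} (hg : Measurable g) :
    ∫⁻ z, g z ∂M.stageLaw D t θ =
      ∫⁻ u, ∫⁻ z, g z ∂(M.addParam U).stageLaw (playParamAt D k φ hφ) t (θ, u) ∂ν := by
  have hG := M.measurable_lintegral_out θ hg
  set G := fun x : (Hist S A Y t × S) × A => ∫⁻ y, g (x, y) ∂M.out (x.1.2, θ) with hGdef
  have e1 : ∫⁻ z, g z ∂M.stageLaw D t θ =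
      ∫⁻ x, ∫⁻ a, G (x, a) ∂D t (θ, x) ∂M.stateLaw D t θ := M.lintegral_actStep _ _ θ hg
  have e2 (u : U) : ∫⁻ z, g z ∂(M.addParam U).stageLaw (playParamAt D k φ hφ) t (θ, u) =
      ∫⁻ x, ∫⁻ a, G (x, a) ∂playParamAt D k φ hφ t ((θ, u), x)
        ∂(M.addParam U).stateLaw (playParamAt D k φ hφ) t (θ, u) :=
    (M.addParam U).lintegral_actStep _ _ (θ, u) hg
  simp only [e1, e2]
  rcases eq_or_ne t k with rfl | h
  · have e3 (u : U) : (M.addParam U).stateLaw (playParamAt D t φ hφ) t (θ, u) =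
        M.stateLaw D t θ :=
      M.addParam_stateLaw_congr D t fun j hj x => playParamAt_of_ne D t φ hφ hj.ne _
    have hGφ : Measurable fun p : (Hist S A Y t × S) × U => G (p.1, φ p.1 p.2) :=
      hG.comp (measurable_fst.prodMk hφ)
    have e4 (x : Hist S A Y t × S) (u : U) :
        ∫⁻ a, G (x, a) ∂Measure.dirac (φ x u) = G (x, φ x u) :=
      lintegral_dirac' _ (hG.comp measurable_prodMk_left)
    simp only [e3, playParamAt_self, e4]
    rw [lintegral_lintegral_swap (f := fun u x => G (x, φ x u))
      (hGφ.comp measurable_swap).aemeasurable]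
    refine lintegral_congr fun x => ?_
    rw [← hD (θ, x)]
    exact lintegral_map (f := fun a => G (x, a)) (hG.comp measurable_prodMk_left)
      hφ.of_uncurry_left
  · simp only [playParamAt_of_ne D k φ hφ h]
    exact hstate _ (hG.lintegral_kernel_prod_right' (κ := (D t).sectR θ))

theorem lintegral_stateLaw_playParamAt (hD : ∀ p, ν.map (φ p.2) = D k p) (θ : O) (t : ℕ)
    {g : Hist S A Y t × S → ℝ≥0∞} (hg : Measurable g) :
    ∫⁻ z, g z ∂M.stateLaw D t θ =
      ∫⁻ u, ∫⁻ z, g z ∂(M.addParam U).stateLaw (playParamAt D k φ hφ) t (θ, u) ∂ν := by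
  induction t with
  | zero =>
    have (u : U) : (M.addParam U).stateLaw (playParamAt D k φ hφ) 0 (θ, u) =
        M.stateLaw D 0 θ :=
      M.addParam_stateLaw_congr D 0 fun j hj => absurd hj j.not_lt_zero
    simp [this]
  | succ t ih =>
    have e (u : U) := (M.addParam U).lintegral_nextStep
      ((M.addParam U).stateLaw (playParamAt D k φ hφ) t) (playParamAt D k φ hφ t) (θ, u) hg
    simp only [stateLaw, e]
    rw [M.lintegral_nextStep _ _ θ hg]
    exact M.lintegral_actStep_playParamAt D k φ hφ hD θ (fun g hg => ih hg)
      (M.measurable_lintegral_trans θ hg)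

/-- A randomised choice at time `k` is a mixture of deterministic ones. -/
theorem lintegral_stageLaw_playAt (hD : ∀ p, ν.map (φ p.2) = D k p) (θ : O) (t : ℕ)
    {g : ((Hist S A Y t × S) × A) × Y → ℝ≥0∞} (hg : Measurable g) :
    ∫⁻ z, g z ∂M.stageLaw D t θ =
      ∫⁻ u, ∫⁻ z, g z ∂(M.addParam U).stageLaw (playParamAt D k φ hφ) t (θ, u) ∂ν :=
  M.lintegral_actStep_playParamAt D k φ hφ hD θ
    (fun _ hg => M.lintegral_stateLaw_playParamAt D k φ hφ hD θ t hg) hg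

end Randomised

end MDPClass

/-! ### Derandomisation under a prior -/

section Comp

variable {X Z : Type*} [MeasurableSpace X] [MeasurableSpace Z] {κ : Kernel X Z} {μ : Measure X}
  {g : Z → ℝ}

theorem integrable_integral_of_integrable_comp (hg : Integrable g (κ ∘ₘ μ)) :
    Integrable (fun x => ∫ z, g z ∂κ x) μ := by
  rw [Measure.comp_eq_comp_const_apply] at hg
  exact hg.integral_comp

theorem integral_measure_comp (hg : Integrable g (κ ∘ₘ μ)) :
    ∫ z, g z ∂(κ ∘ₘ μ) = ∫ x, ∫ z, g z ∂κ x ∂μ := by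
  rw [Measure.comp_eq_comp_const_apply] at hg ⊢
  exact Kernel.integral_comp hg

end Comp

namespace MDPClass

variable {S A Y O : Type*} [MeasurableSpace S] [MeasurableSpace A] [MeasurableSpace Y]
  [MeasurableSpace O] (M : MDPClass S A Y O)

/-- Law of (history, state, action, outcome) at time `t` when the parameter is drawn from `P` and
actions follow `D`. -/
def priorStageLaw (P : Measure O) (D : Rule S A Y O) (t : ℕ) :
    Measure (((Hist S A Y t × S) × A) × Y) :=
  M.stageLaw D t ∘ₘ P

theorem lintegral_priorStageLaw (P : Measure O) (D : Rule S A Y O) (t : ℕ)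
    {g : ((Hist S A Y t × S) × A) × Y → ℝ≥0∞} (hg : Measurable g) :
    ∫⁻ z, g z ∂M.priorStageLaw P D t = ∫⁻ θ, ∫⁻ z, g z ∂M.stageLaw D t θ ∂P :=
  Measure.lintegral_bind (M.stageLaw D t).measurable.aemeasurable hg.aemeasurable

section Derandomise

variable (P : Measure O) [IsProbabilityMeasure P] {U : Type*} [MeasurableSpace U] {ν : Measure U}
  [IsProbabilityMeasure ν]

/-- The stage law under a prior, as a function of the additional parameter. -/
def noiseStageLaw (D : Rule S A Y (O × U)) (t : ℕ) :
    Kernel U (((Hist S A Y t × S) × A) × Y) :=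
  (M.addParam U).stageLaw D t ∘ₖ (Kernel.const U P ×ₖ Kernel.id)

theorem lintegral_noiseStageLaw (D : Rule S A Y (O × U)) (t : ℕ) (u : U)
    {g : ((Hist S A Y t × S) × A) × Y → ℝ≥0∞} (hg : Measurable g) :
    ∫⁻ z, g z ∂M.noiseStageLaw P D t u =
      ∫⁻ θ, ∫⁻ z, g z ∂(M.addParam U).stageLaw D t (θ, u) ∂P := by
  have hm : Measurable fun p : O × U => ∫⁻ z, g z ∂(M.addParam U).stageLaw D t p :=
    hg.lintegral_kernel
  rw [noiseStageLaw, Kernel.lintegral_comp _ _ _ hg, Kernel.prod_apply, Kernel.const_apply,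
    Kernel.id_apply, lintegral_prod _ hm.aemeasurable]
  exact lintegral_congr fun θ => lintegral_dirac' u (hm.comp measurable_prodMk_left)

variable (D : Rule S A Y O) [∀ t, IsMarkovKernel (D t)] (k : ℕ) (φ : Hist S A Y k × S → U → A)
  (hφ : Measurable φ.uncurry)

theorem noiseStageLaw_playParamAt (t : ℕ) (u : U) :
    M.noiseStageLaw P (playParamAt D k φ hφ) t u =
      M.priorStageLaw P (playAt D k (fun x => φ x u) hφ.of_uncurry_right) t := by
  refine Measure.ext_of_lintegral _ fun g hg => ?_
  rw [lintegral_noiseStageLaw _ _ _ _ _ hg, lintegral_priorStageLaw _ _ _ _ hg]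
  simp only [stageLaw_playParamAt]

theorem noiseStageLaw_comp (hD : ∀ p, ν.map (φ p.2) = D k p) (t : ℕ) :
    M.noiseStageLaw P (playParamAt D k φ hφ) t ∘ₘ ν = M.priorStageLaw P D t := by
  refine Measure.ext_of_lintegral _ fun g hg => ?_
  have hm : Measurable fun p : O × U =>
      ∫⁻ z, g z ∂(M.addParam U).stageLaw (playParamAt D k φ hφ) t p := hg.lintegral_kernel
  rw [Measure.lintegral_bind (Kernel.measurable _).aemeasurable hg.aemeasurable,
    lintegral_priorStageLaw _ _ _ _ hg]
  simp only [lintegral_noiseStageLaw _ _ _ _ _ hg, M.lintegral_stageLaw_playAt D k φ hφ hD _ t hg]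
  exact lintegral_lintegral_swap
    (f := fun u θ => ∫⁻ z, g z ∂(M.addParam U).stageLaw (playParamAt D k φ hφ) t (θ, u))
    (hm.comp measurable_swap).aemeasurable

/-- A randomised choice at one time can be replaced by a deterministic one without loss of expected
reward. -/
theorem exists_playAt_integral_le (hφ : Measurable φ.uncurry)
    (hD : ∀ p, ν.map (φ p.2) = D k p) (T : ℕ)
    (hint : ∀ t : Fin T, Integrable M.stageReward (M.priorStageLaw P D t)) :
    ∃ (ψ : Hist S A Y k × S → A) (hψ : Measurable ψ),
      (∀ t : Fin T, Integrable M.stageReward (M.priorStageLaw P (playAt D k ψ hψ) t)) ∧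
      ∑ t : Fin T, ∫ z, M.stageReward z ∂M.priorStageLaw P D t ≤
        ∑ t : Fin T, ∫ z, M.stageReward z ∂M.priorStageLaw P (playAt D k ψ hψ) t := by
  simp only [← M.noiseStageLaw_comp P D k φ hφ hD] at hint ⊢
  have hae : ∀ᵐ u ∂ν, ∀ t : Fin T, Integrable M.stageReward
      (M.noiseStageLaw P (playParamAt D k φ hφ) t u) :=
    ae_all_iff.2 fun t => Measure.ae_integrable_of_integrable_comp (hint t)
  have hi (t : Fin T) := integrable_integral_of_integrable_comp (hint t)
  have he (t : Fin T) := integral_measure_comp (hint t)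
  -- Some noise value outside the null set of bad integrability attains at least the mean.
  obtain ⟨u, hu, hle⟩ := exists_notMem_null_integral_le
    (integrable_finsetSum Finset.univ fun t _ => hi t) (ae_iff.1 hae)
  rw [integral_finsetSum _ fun t _ => hi t] at hle
  simp only [Set.mem_ofPred_eq, not_not] at hu
  simp only [M.noiseStageLaw_playParamAt P D k φ hφ] at hu hle
  refine ⟨fun x => φ x u, hφ.of_uncurry_right, hu, ?_⟩
  simpa only [he, M.noiseStageLaw_playParamAt P D k φ hφ] using hle

end Derandomise

/-- A randomised rule that does not use the parameter is, under any prior, no better than some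
deterministic policy. -/
theorem exists_policy_integral_le (P : Measure O) [IsProbabilityMeasure P] {U : Type*}
    [MeasurableSpace U] (ν : Measure U) [IsProbabilityMeasure ν] (D : Rule S A Y O)
    [hM : ∀ t, IsMarkovKernel (D t)] (T : ℕ)
    (hD : ∀ t, ∃ φ : Hist S A Y t × S → U → A, Measurable φ.uncurry ∧
      ∀ p, ν.map (φ p.2) = D t p)
    (hint : ∀ t : Fin T, Integrable M.stageReward (M.priorStageLaw P D t)) :
    ∃ π : Policy S A Y T,
      (∀ t : Fin T, Integrable M.stageReward (M.priorStageLaw P (policyRule π) t)) ∧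
      ∑ t : Fin T, ∫ z, M.stageReward z ∂M.priorStageLaw P D t ≤
        ∑ t : Fin T, ∫ z, M.stageReward z ∂M.priorStageLaw P (policyRule π) t := by
  -- After `n` steps the rule is deterministic before time `n` and unchanged from time `n` on. The
  -- later kernels are kept as they are, even though the law of the history changes.
  suffices h : ∀ n, ∃ D' : Rule S A Y O, (∀ t, IsMarkovKernel (D' t)) ∧
      (∀ t < n, ∃ ψ : Hist S A Y t × S → A, Measurable ψ ∧ ∀ p, D' t p = Measure.dirac (ψ p.2)) ∧
      (∀ t, n ≤ t → D' t = D t) ∧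
      (∀ t : Fin T, Integrable M.stageReward (M.priorStageLaw P D' t)) ∧
      ∑ t : Fin T, ∫ z, M.stageReward z ∂M.priorStageLaw P D t ≤
        ∑ t : Fin T, ∫ z, M.stageReward z ∂M.priorStageLaw P D' t by
    obtain ⟨D', hM', hdet, -, hint', hle⟩ := h T
    choose ψ hψ hψD using hdet
    let π : Policy S A Y T := ⟨fun t => ψ t t.2, fun t => hψ t t.2⟩
    have he (t : Fin T) : M.priorStageLaw P (policyRule π) t = M.priorStageLaw P D' t := by
      refine Measure.comp_congr (.of_forall fun θ => ?_)
      refine stageLaw_congr rfl (fun _ _ => rfl) (fun _ => rfl) _ fun j hj x => ?_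
      rw [policyRule_apply π (hj.trans_lt t.2), hψD j (hj.trans_lt t.2)]
    exact ⟨π, by simpa only [he] using hint', by simpa only [he] using hle⟩
  intro n
  induction n with
  | zero => exact ⟨D, hM, fun t ht => absurd ht t.not_lt_zero, fun _ _ => rfl, hint, le_rfl⟩
  | succ n ih =>
    obtain ⟨D', hM', hdet, heq, hint', hle⟩ := ih
    obtain ⟨φ, hφ, hφD⟩ := hD n
    obtain ⟨ψ, hψ, hψi, hψle⟩ := M.exists_playAt_integral_le P D' n φ hφ (ν := ν)
      (by rwa [heq n le_rfl]) T hint'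
    refine ⟨playAt D' n ψ hψ, inferInstance, fun t ht => ?_, fun t ht => ?_, hψi,
      hle.trans hψle⟩
    · rcases Nat.lt_succ_iff_lt_or_eq.1 ht with h | rfl
      · rw [playAt, Function.update_of_ne h.ne]
        exact hdet t h
      · refine ⟨ψ, hψ, fun p => ?_⟩
        rw [playAt, Function.update_self, Kernel.deterministic_apply]
    · rw [playAt, Function.update_of_ne (Nat.succ_le_iff.1 ht).ne']
      exact heq t (Nat.le_of_succ_le ht)

end MDPClass

/-! ### Thompson sampling and decoupling -/

namespace MDPClass

variable {S A Y O : Type*} [MeasurableSpace S] [MeasurableSpace A] [MeasurableSpace Y]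
  [MeasurableSpace O] (M : MDPClass S A Y O)

/-- The pair (outcome, action) of a stage, on which the reward depends. -/
def outcomeAction {t : ℕ} (x : ((Hist S A Y t × S) × A) × Y) : Y × A := (x.2, x.1.2)

@[fun_prop]
theorem measurable_outcomeAction {t : ℕ} :
    Measurable (outcomeAction (S := S) (A := A) (Y := Y) (t := t)) := by
  unfold outcomeAction
  fun_prop

section Star

variable (f : {f : S × O → A // Measurable f})

theorem measurable_outcome_optimalAction (θ : O) :
    Measurable fun z : Y × S => (z.1, f.1 (z.2, θ)) := by
  have := f.2
  fun_prop

theorem measurable_decoupledAction (t : ℕ) :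
    Measurable fun x : (O × Hist S A Y t) × (Y × S) => (x.2.1, f.1 (x.2.2, x.1.1)) := by
  have hf := f.2
  fun_prop

/-- The action is a function of state and parameter, and the outcome kernel ignores the action, so
outcome and state determine the reward. -/
theorem map_outcomeAction_stageLaw_paramRule (t : ℕ) (θ : O) :
    (M.stageLaw (paramRule f) t θ).map outcomeAction =
      (M.starLaw f t θ).map fun z => (z.1, f.1 (z.2, θ)) := by
  have hf := f.2
  have := M.markov_out
  refine Measure.ext_of_lintegral _ fun g hg => ?_
  rw [lintegral_map hg measurable_outcomeAction,
    lintegral_map hg (measurable_outcome_optimalAction f θ), starLaw,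
    Kernel.map_apply _ (by fun_prop), lintegral_map (by fun_prop) (by fun_prop), stageLaw,
    lintegral_actStep _ _ _ _ (by fun_prop),
    lintegral_actStep _ _ _ _ (by fun_prop)]
  refine lintegral_congr fun x => ?_
  simp only [paramRule, Kernel.deterministic_apply]
  rw [lintegral_dirac', lintegral_dirac']
  · rfl
  · exact measurable_const
  · exact Measurable.lintegral_prod_right' (ν := M.out (x.2, θ)) (hg.comp measurable_swap)

theorem integrable_starLaw_iff (t : ℕ) (θ : O) :
    Integrable (fun z => M.reward (z.1, f.1 (z.2, θ))) (M.starLaw f t θ) ↔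
      Integrable M.stageReward (M.stageLaw (paramRule f) t θ) := by
  have h1 := integrable_map_measure (μ := M.starLaw f t θ)
    M.measurable_reward.aestronglyMeasurable (measurable_outcome_optimalAction f θ).aemeasurable
  have h2 := integrable_map_measure (μ := M.stageLaw (paramRule f) t θ)
    M.measurable_reward.aestronglyMeasurable measurable_outcomeAction.aemeasurable
  rw [map_outcomeAction_stageLaw_paramRule] at h2
  exact h1.symm.trans h2

theorem integral_starLaw (t : ℕ) (θ : O) :
    ∫ z, M.reward (z.1, f.1 (z.2, θ)) ∂M.starLaw f t θ =
      ∫ x, M.stageReward x ∂M.stageLaw (paramRule f) t θ := by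
  have h1 := integral_map (measurable_outcome_optimalAction f θ).aemeasurable
    (M.measurable_reward.aestronglyMeasurable (μ := (M.starLaw f t θ).map _))
  have h2 := integral_map (μ := M.stageLaw (paramRule f) t θ)
    measurable_outcomeAction.aemeasurable M.measurable_reward.aestronglyMeasurable
  rw [map_outcomeAction_stageLaw_paramRule] at h2
  exact h1.symm.trans h2

theorem utility_stationary_slice (θ : O) :
    M.utility (stationary M.horizon (slice f θ)) θ =
      ∑ t : Fin M.horizon, ∫ z, M.reward (z.1, f.1 (z.2, θ)) ∂M.starLaw f t θ := by
  simp only [utility, M.stageLaw_stationary_slice f θ (Fin.is_lt _), integral_starLaw]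

instance isMarkovKernel_starLaw (t : ℕ) : IsMarkovKernel (M.starLaw f t) :=
  Kernel.IsMarkovKernel.map _ (by fun_prop)

end Star

section Thompson

variable [StandardBorelSpace O] [Nonempty O] (P : Measure O) [IsProbabilityMeasure P]
  (f : {f : S × O → A // Measurable f})

/-- Thompson sampling as a rule. -/
def thompsonSampling : Rule S A Y O := fun t => thompsonRule P f (M.thompsonLaw P f t)

instance (t : ℕ) : IsMarkovKernel (M.thompsonSampling P f t) :=
  inferInstanceAs (IsMarkovKernel (thompsonRule P f (M.thompsonLaw P f t)))

/-- Thompson sampling is defined by a joint recursion, its rule at `t` needing the law up to `t`.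
Once built, it is an ordinary rule. -/
theorem stateLaw_thompsonSampling (t : ℕ) :
    M.stateLaw (M.thompsonSampling P f) t = M.thompsonLaw P f t := by
  induction t with
  | zero => rfl
  | succ t ih =>
    simp only [stateLaw, ih]
    rfl

theorem stageLaw_thompsonSampling (t : ℕ) :
    M.stageLaw (M.thompsonSampling P f) t =
      M.actStep (M.thompsonLaw P f t) (thompsonRule P f (M.thompsonLaw P f t)) := by
  rw [stageLaw, stateLaw_thompsonSampling]
  rfl

theorem thompsonRule_apply {t : ℕ} (K : Kernel O (Hist S A Y t × S)) [IsMarkovKernel K]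
    (p : O × (Hist S A Y t × S)) :
    thompsonRule P f K p = (posterior K.fst P p.2.1).map fun θ => f.1 (p.2.2, θ) := by
  have hf := f.2
  rw [thompsonRule, Kernel.map_apply _ (by fun_prop), Kernel.prod_apply, Kernel.comap_apply,
    Kernel.deterministic_apply, Measure.prod_dirac, Measure.map_map (by fun_prop) (by fun_prop)]
  rfl

/-- The random choice in Thompson sampling is made by independent uniform noise. -/
theorem exists_map_eq_thompsonSampling (t : ℕ) :
    ∃ φ : Hist S A Y t × S → unitInterval → A, Measurable φ.uncurry ∧
      ∀ p, (volume : Measure unitInterval).map (φ p.2) = M.thompsonSampling P f t p := by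
  have hf := f.2
  -- The noise represents the posterior on the standard Borel space `O`; `A` is an arbitrary
  -- measurable space.
  obtain ⟨ψ, hψ, hψP⟩ :=
    (posterior (M.thompsonLaw P f t).fst P).exists_measurable_map_eq_unitInterval
  refine ⟨fun x u => f.1 (x.2, ψ x.1 u), ?_, fun p => ?_⟩
  · exact hf.comp (measurable_fst.snd.prodMk
      (hψ.comp (measurable_fst.fst.prodMk measurable_snd)))
  · rw [thompsonSampling, thompsonRule_apply, ← hψP,
      Measure.map_map (by fun_prop) hψ.of_uncurry_left]
    rfl

theorem lintegral_thompsonJoint (t : ℕ) {g : O × (((Hist S A Y t × S) × A) × Y) → ℝ≥0∞}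
    (hg : Measurable g) :
    ∫⁻ x, g x ∂M.thompsonJoint P f t =
      ∫⁻ θ, ∫⁻ x, ∫⁻ a, ∫⁻ y, g (θ, ((x, a), y)) ∂M.out (x.2, θ)
        ∂thompsonRule P f (M.thompsonLaw P f t) (θ, x) ∂M.thompsonLaw P f t θ ∂P := by
  have := M.isMarkovKernel_actStep (M.thompsonLaw P f t)
    (thompsonRule P f (M.thompsonLaw P f t))
  rw [thompsonJoint, Measure.lintegral_compProd hg]
  exact lintegral_congr fun θ => M.lintegral_actStep _ _ θ (hg.comp measurable_prodMk_left)

theorem thompsonHist_eq (t : ℕ) :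
    M.thompsonHist P f t = P.compProd (M.thompsonLaw P f t).fst := by
  have := M.markov_out
  refine Measure.ext_of_lintegral _ fun g hg => ?_
  rw [thompsonHist, lintegral_map hg (by fun_prop), lintegral_thompsonJoint _ _ _ _ (by fun_prop),
    Measure.lintegral_compProd hg]
  refine lintegral_congr fun θ => ?_
  simp only [lintegral_const, measure_univ, mul_one]
  rw [Kernel.fst_apply, lintegral_map (by fun_prop) measurable_fst]

instance (t : ℕ) : IsProbabilityMeasure (M.thompsonHist P f t) := by
  rw [thompsonHist_eq]
  infer_instance

theorem thompsonHist_fst (t : ℕ) : (M.thompsonHist P f t).fst = P := by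
  rw [thompsonHist_eq, Measure.fst_compProd]

/-- Under Thompson sampling the parameter drawn from the posterior and the true parameter have the
same joint law with the history. -/
theorem compProd_posterior_thompsonLaw (t : ℕ) :
    (M.thompsonHist P f t).snd.compProd (posterior (M.thompsonLaw P f t).fst P) =
      (M.thompsonHist P f t).map Prod.swap := by
  rw [thompsonHist_eq, Measure.snd_compProd, compProd_posterior_eq_map_swap]

variable [StandardBorelSpace Y] [Nonempty Y] [StandardBorelSpace S] [Nonempty S]

instance (t : ℕ) : IsMarkovKernel (M.predictive P f t) := by
  unfold predictive
  infer_instance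

/-- Joint law of parameter, history, outcome and state, where outcome and state are drawn from their
conditional law given the history, independently of the parameter. -/
def decoupledLaw (t : ℕ) : Measure ((O × Hist S A Y t) × (Y × S)) :=
  (M.thompsonHist P f t).compProd ((M.predictive P f t).comap Prod.snd measurable_snd)

theorem compProd_predictive (t : ℕ) :
    (M.thompsonHist P f t).snd.compProd (M.predictive P f t) =
      (M.thompsonJoint P f t).map fun x => (x.2.1.1.1, (x.2.2, x.2.1.1.2)) := by
  rw [thompsonHist, Measure.snd, Measure.map_map (by fun_prop) (by fun_prop)]
  exact compProd_map_condDistrib (by fun_prop)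

/-- Under Thompson sampling, outcome and action are distributed as if the action were optimal for a
parameter that is independent of outcome and state given the history. -/
theorem map_outcomeAction_thompsonSampling (t : ℕ) :
    (M.priorStageLaw P (M.thompsonSampling P f) t).map outcomeAction =
      (M.decoupledLaw P f t).map fun x => (x.2.1, f.1 (x.2.2, x.1.1)) := by
  have hf := f.2
  have := M.markov_out
  refine Measure.ext_of_lintegral _ fun g hg => ?_
  let post := posterior (M.thompsonLaw P f t).fst P
  -- `G` averages over the posterior draw. Both sides reduce to the integral of `G` against the law
  -- of history, outcome and state.
  let G : Hist S A Y t × (Y × S) → ℝ≥0∞ := fun x =>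
    ∫⁻ θ, g (x.2.1, f.1 (x.2.2, θ)) ∂post x.1
  have hG : Measurable G :=
    Measurable.lintegral_kernel_prod_right' (κ := post.comap Prod.fst measurable_fst)
      (f := fun x : (Hist S A Y t × (Y × S)) × O => g (x.1.2.1, f.1 (x.1.2.2, x.2)))
      (by fun_prop)
  have hleft : ∫⁻ z, g z ∂(M.priorStageLaw P (M.thompsonSampling P f) t).map outcomeAction =
      ∫⁻ x, G (x.2.1.1.1, (x.2.2, x.2.1.1.2)) ∂M.thompsonJoint P f t := by
    rw [lintegral_map hg measurable_outcomeAction,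
      lintegral_priorStageLaw _ _ _ _ (by fun_prop),
      stageLaw_thompsonSampling, lintegral_thompsonJoint _ _ _ _ (by fun_prop)]
    refine lintegral_congr fun θ => ?_
    rw [lintegral_actStep _ _ _ _ (by fun_prop)]
    refine lintegral_congr fun x => ?_
    simp only [lintegral_const, measure_univ, mul_one]
    rw [thompsonRule_apply, lintegral_map
      (Measurable.lintegral_prod_right' (ν := M.out (x.2, θ))
        (f := fun p : A × Y => g (outcomeAction ((x, p.1), p.2)))
        (by unfold outcomeAction; fun_prop)) (by fun_prop)]
    exact lintegral_lintegral_swap (f := fun θ' y => g (y, f.1 (x.2, θ')))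
      (Measurable.aemeasurable (by fun_prop))
  have hright : ∫⁻ z, g z ∂(M.decoupledLaw P f t).map
      (fun x => (x.2.1, f.1 (x.2.2, x.1.1))) =
      ∫⁻ x, G x ∂(M.thompsonHist P f t).snd.compProd (M.predictive P f t) := by
    have hm : Measurable fun p : O × Hist S A Y t =>
        ∫⁻ z, g (z.1, f.1 (z.2, p.1)) ∂M.predictive P f t p.2 :=
      Measurable.lintegral_kernel_prod_right'
        (κ := (M.predictive P f t).comap Prod.snd measurable_snd)
        (f := fun x : (O × Hist S A Y t) × (Y × S) => g (x.2.1, f.1 (x.2.2, x.1.1)))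
        (by fun_prop)
    have hm' : Measurable fun q : Hist S A Y t × O =>
        ∫⁻ z, g (z.1, f.1 (z.2, q.2)) ∂M.predictive P f t q.1 := hm.comp measurable_swap
    have hswap : ∫⁻ p, ∫⁻ z, g (z.1, f.1 (z.2, p.1)) ∂M.predictive P f t p.2
        ∂M.thompsonHist P f t =
        ∫⁻ q, ∫⁻ z, g (z.1, f.1 (z.2, q.2)) ∂M.predictive P f t q.1
          ∂(M.thompsonHist P f t).map Prod.swap := by
      rw [lintegral_map hm' measurable_swap]
      rfl
    rw [lintegral_map hg (measurable_decoupledAction f t), decoupledLaw,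
      Measure.lintegral_compProd (by fun_prop)]
    simp only [Kernel.comap_apply]
    -- The true parameter is exchanged for a posterior draw; given the history, Tonelli then swaps
    -- it with outcome and state.
    rw [hswap, ← compProd_posterior_thompsonLaw,
      Measure.lintegral_compProd hm', Measure.lintegral_compProd hG]
    refine lintegral_congr fun h => ?_
    exact lintegral_lintegral_swap (μ := post h) (ν := M.predictive P f t h)
      (f := fun θ (z : Y × S) => g (z.1, f.1 (z.2, θ)))
      (Measurable.aemeasurable (by fun_prop))
  rw [hleft, hright, compProd_predictive, lintegral_map hG (by fun_prop)]

theorem integrable_thompsonSampling_iff (t : ℕ) :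
    Integrable M.stageReward (M.priorStageLaw P (M.thompsonSampling P f) t) ↔
      Integrable (fun x => M.reward (x.2.1, f.1 (x.2.2, x.1.1))) (M.decoupledLaw P f t) := by
  have h1 := integrable_map_measure (μ := M.decoupledLaw P f t)
    M.measurable_reward.aestronglyMeasurable (measurable_decoupledAction f t).aemeasurable
  have h2 := integrable_map_measure (μ := M.priorStageLaw P (M.thompsonSampling P f) t)
    M.measurable_reward.aestronglyMeasurable measurable_outcomeAction.aemeasurable
  rw [map_outcomeAction_thompsonSampling] at h2
  exact h2.symm.trans h1

theorem integral_thompsonSampling (t : ℕ) :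
    ∫ x, M.stageReward x ∂M.priorStageLaw P (M.thompsonSampling P f) t =
      ∫ x, M.reward (x.2.1, f.1 (x.2.2, x.1.1)) ∂M.decoupledLaw P f t := by
  have h1 := integral_map (measurable_decoupledAction f t).aemeasurable
    (M.measurable_reward.aestronglyMeasurable (μ := (M.decoupledLaw P f t).map _))
  have h2 := integral_map (μ := M.priorStageLaw P (M.thompsonSampling P f) t)
    measurable_outcomeAction.aemeasurable M.measurable_reward.aestronglyMeasurable
  rw [map_outcomeAction_thompsonSampling] at h2
  exact h2.symm.trans h1

end Thompson

end MDPClass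

/-! ### Measurable selection and integral bounds -/

/-- If every point admits an index at which a continuous function is below `ε`, then such an index
can be selected measurably among countably many. -/
theorem exists_measurable_selection_lt {O ι : Type*} [TopologicalSpace O]
    [SecondCountableTopology O] [Nonempty O] [MeasurableSpace O] [BorelSpace O] (F : ι → O → ℝ)
    (hF : ∀ i, Continuous (F i)) (ε : ℝ) (h : ∀ θ, ∃ i, F i θ < ε) :
    ∃ (i : ℕ → ι) (n : O → ℕ), Measurable n ∧ ∀ θ, F (i (n θ)) θ < ε := by
  classical
  choose j hj using h
  have hopen (θ : O) : IsOpen {θ' | F (j θ) θ' < ε} := isOpen_lt (hF _) continuous_const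
  -- By second countability, countably many of these open sets cover; the least valid index is a
  -- measurable choice.
  obtain ⟨s, hs, hcover⟩ := TopologicalSpace.countable_cover_nhds fun θ =>
    (hopen θ).mem_nhds (hj θ)
  have hex (θ : O) : ∃ θ' ∈ s, F (j θ') θ < ε := by
    have := hcover.symm.subset (Set.mem_univ θ)
    simpa using this
  have hne : s.Nonempty := let ⟨θ', h', _⟩ := hex (Classical.arbitrary O); ⟨θ', h'⟩
  obtain ⟨e, rfl⟩ := hs.exists_eq_range hne
  have hex' (θ : O) : ∃ n, F (j (e n)) θ < ε := by simpa using hex θ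
  exact ⟨fun n => j (e n), fun θ => Nat.find (hex' θ),
    measurable_find hex' fun n => (hopen (e n)).measurableSet, fun θ => Nat.find_spec (hex' θ)⟩

theorem measurable_countable_selection {X : Type*} [MeasurableSpace X] {F : ℕ → X → ℝ}
    (hF : ∀ k, Measurable (F k)) {n : X → ℕ} (hn : Measurable n) :
    Measurable fun x => F (n x) x :=
  (measurable_from_prod_countable_right (f := fun p : ℕ × X => F p.1 p.2) hF).comp
    (hn.prodMk measurable_id)

/-- `B` need not be measurable: the divergence or transport cost as a function of parameter and
history enters only through monotonicity of the lower integral. -/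
theorem integral_le_toReal_lintegral {X : Type*} [MeasurableSpace X] {μ : Measure X} {g : X → ℝ}
    (hg : Integrable g μ) {B : X → ℝ≥0∞} (hB : ∫⁻ x, B x ∂μ ≠ ∞)
    (hle : ∀ᵐ x ∂μ, ENNReal.ofReal (g x) ≤ B x) : ∫ x, g x ∂μ ≤ (∫⁻ x, B x ∂μ).toReal := by
  rw [integral_eq_lintegral_pos_part_sub_lintegral_neg_part hg]
  exact (sub_le_self _ ENNReal.toReal_nonneg).trans
    (ENNReal.toReal_mono hB (lintegral_mono_ae hle))

/-! ### From Bayesian regret to minimax regret -/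

namespace MDPClass

variable {S A Y O : Type*} [MeasurableSpace S] [MeasurableSpace A] [MeasurableSpace Y]

section Utility

variable [MeasurableSpace O] (M : MDPClass S A Y O)

theorem measurable_utility (π : Policy S A Y M.horizon) : Measurable (M.utility π) :=
  Finset.measurable_sum _ fun t _ =>
    (M.measurable_stageReward.stronglyMeasurable.integral_kernel
      (κ := M.stageLaw (policyRule π) t)).measurable

variable {M} {P : Measure O}

/-- A supremum over uncountably many maps need not be measurable. Here it is the continuous regret
of one fixed policy plus its measurable utility. -/
theorem measurable_optimalUtility [TopologicalSpace O] [OpensMeasurableSpace O] [Nonempty O]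
    (f : {f : S × O → A // Measurable f})
    (hcont : ∀ π, Continuous fun θ => M.regret π θ) : Measurable M.optimalUtility := by
  let π := stationary (Y := Y) M.horizon (slice f (Classical.arbitrary O))
  have h : M.optimalUtility = fun θ => M.regret π θ + M.utility π θ :=
    funext fun θ => (sub_add_cancel _ _).symm
  rw [h]
  exact (hcont π).measurable.add (M.measurable_utility π)

theorem integrable_utility {π : Policy S A Y M.horizon}
    (h : ∀ t : Fin M.horizon, Integrable M.stageReward (M.priorStageLaw P (policyRule π) t)) :
    Integrable (M.utility π) P :=
  integrable_finsetSum _ fun t _ => integrable_integral_of_integrable_comp (h t)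

theorem integral_utility {π : Policy S A Y M.horizon}
    (h : ∀ t : Fin M.horizon, Integrable M.stageReward (M.priorStageLaw P (policyRule π) t)) :
    ∫ θ, M.utility π θ ∂P =
      ∑ t : Fin M.horizon, ∫ x, M.stageReward x ∂M.priorStageLaw P (policyRule π) t := by
  unfold utility
  rw [integral_finsetSum _ fun t _ => integrable_integral_of_integrable_comp (h t)]
  exact Finset.sum_congr rfl fun t _ => (integral_measure_comp (h t)).symm

namespace IsOptimal

variable [IsProbabilityMeasure P] {f : {f : S × O → A // Measurable f}}

theorem integrable_priorStageLaw (hf : M.IsOptimal P f) (t : Fin M.horizon) :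
    Integrable M.stageReward (M.priorStageLaw P (paramRule f) t) :=
  (Measure.integrable_compProd_snd_iff M.measurable_stageReward.aestronglyMeasurable).1
    (hf.integrable t)

theorem ae_integrable_starLaw (hf : M.IsOptimal P f) (t : Fin M.horizon) :
    ∀ᵐ θ ∂P, Integrable (fun z => M.reward (z.1, f.1 (z.2, θ))) (M.starLaw f t θ) := by
  filter_upwards [Measure.ae_integrable_of_integrable_comp (hf.integrable_priorStageLaw t)]
    with θ hθ
  exact (M.integrable_starLaw_iff f t θ).2 hθ

theorem integrable_integral_starLaw (hf : M.IsOptimal P f) (t : Fin M.horizon) :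
    Integrable (fun θ => ∫ z, M.reward (z.1, f.1 (z.2, θ)) ∂M.starLaw f t θ) P := by
  simp only [integral_starLaw]
  exact integrable_integral_of_integrable_comp (hf.integrable_priorStageLaw t)

theorem lintegral_enorm_starLaw_ne_top (hf : M.IsOptimal P f) (t : Fin M.horizon) :
    ∫⁻ θ, ∫⁻ z, ‖M.reward (z.1, f.1 (z.2, θ))‖ₑ ∂M.starLaw f t θ ∂P ≠ ∞ := by
  have hr : Measurable fun x : Y × A => ‖M.reward x‖ₑ := M.measurable_reward.enorm
  have h (θ : O) : ∫⁻ z, ‖M.reward (z.1, f.1 (z.2, θ))‖ₑ ∂M.starLaw f t θ =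
      ∫⁻ x, ‖M.stageReward x‖ₑ ∂M.stageLaw (paramRule f) t θ := by
    have h1 := lintegral_map (μ := M.starLaw f t θ) hr (measurable_outcome_optimalAction f θ)
    have h2 := lintegral_map (μ := M.stageLaw (paramRule f) t θ) hr measurable_outcomeAction
    rw [map_outcomeAction_stageLaw_paramRule] at h2
    exact h1.symm.trans h2
  simp only [h]
  rw [← M.lintegral_priorStageLaw P (paramRule f) t M.measurable_stageReward.enorm]
  exact (hf.integrable_priorStageLaw t).2.ne

theorem integrable_utility_slice (hf : M.IsOptimal P f) :
    Integrable (fun θ => M.utility (stationary M.horizon (slice f θ)) θ) P := by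
  simp only [utility_stationary_slice]
  exact integrable_finsetSum _ fun t _ => hf.integrable_integral_starLaw t

theorem integral_utility_slice (hf : M.IsOptimal P f) :
    ∫ θ, M.utility (stationary M.horizon (slice f θ)) θ ∂P =
      ∑ t : Fin M.horizon, ∫ θ, ∫ z, M.reward (z.1, f.1 (z.2, θ)) ∂M.starLaw f t θ ∂P := by
  simp only [utility_stationary_slice]
  exact integral_finsetSum _ fun t _ => hf.integrable_integral_starLaw t

/-- It differs from the integrable utility of `f` by a bounded regret. -/
theorem integrable_optimalUtility [TopologicalSpace O] [OpensMeasurableSpace O] [Nonempty O]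
    (hf : M.IsOptimal P f)
    (hbdd : ∃ C : ℝ, ∀ π θ, |M.regret π θ| ≤ C) (hcont : ∀ π, Continuous fun θ => M.regret π θ) :
    Integrable M.optimalUtility P := by
  obtain ⟨C, hC⟩ := hbdd
  have hJ := hf.integrable_utility_slice
  have h : Integrable (fun θ => M.regret (stationary M.horizon (slice f θ)) θ) P :=
    .of_bound ((measurable_optimalUtility f hcont).aestronglyMeasurable.sub hJ.1) C
      (.of_forall fun θ => hC _ θ)
  exact (h.add hJ).congr (.of_forall fun θ => sub_add_cancel _ _)

end IsOptimal

end Utility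

/-- Bounds for the Bayesian regret that depend on the prior bound the minimax regret. -/
theorem minimaxRegret_le_iSup [MetricSpace O] [CompactSpace O] [MeasurableSpace O]
    [BorelSpace O] {M : MDPClass S A Y O} [MeasurableSpace (Policy S A Y M.horizon)]
    [Nonempty (Policy S A Y M.horizon)] (hmeas : ∀ θ, Measurable fun π => M.regret π θ)
    (hbdd : ∃ C : ℝ, ∀ π θ, |M.regret π θ| ≤ C) (hcont : ∀ π, Continuous fun θ => M.regret π θ)
    (b : ProbabilityMeasure O → ℝ≥0∞)
    (h : ∀ P, b P ≠ ∞ → ∃ π, ∫ θ, M.regret π θ ∂(P : Measure O) ≤ (b P).toReal) :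
    M.minimaxRegret ≤ ⨆ P, (b P : EReal) := by
  refine EReal.le_of_forall_lt_iff_le.1 fun z hz => ?_
  refine M.minimaxRegret_le_of_forall_prior hmeas hbdd hcont z fun P => ?_
  have hP : (b P : EReal) < z := (le_iSup (fun P => (b P : EReal)) P).trans_lt hz
  have hne : b P ≠ ∞ := fun h => by simp [h] at hP
  refine (h P hne).imp fun π hπ => hπ.trans ?_
  rw [← ENNReal.ofReal_toReal hne] at hP
  have := EReal.coe_ennreal_ofReal (x := (b P).toReal)
  rw [this, max_eq_left ENNReal.toReal_nonneg] at hP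
  exact (EReal.coe_lt_coe_iff.1 hP).le

section Compact

variable [MetricSpace O] [CompactSpace O] [Nonempty O] [MeasurableSpace O] [BorelSpace O]
  {M : MDPClass S A Y O} {P : Measure O} [IsProbabilityMeasure P]
  {f : {f : S × O → A // Measurable f}}

/-- The expected optimal utility is attained by an optimal `f`: near-optimal maps can be chosen
measurably in the parameter. -/
theorem IsOptimal.integral_optimalUtility_le (hf : M.IsOptimal P f)
    (hbdd : ∃ C : ℝ, ∀ π θ, |M.regret π θ| ≤ C) (hcont : ∀ π, Continuous fun θ => M.regret π θ) :
    ∫ θ, M.optimalUtility θ ∂P ≤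
      ∫ θ, M.utility (stationary M.horizon (slice f θ)) θ ∂P := by
  have hU := hf.integrable_optimalUtility hbdd hcont
  obtain ⟨C, hC⟩ := hbdd
  have : Nonempty {g : S → A // Measurable g} := ⟨slice f (Classical.arbitrary O)⟩
  have hle (g : {g : S → A // Measurable g}) (θ : O) :
      M.utility (stationary M.horizon g) θ ≤ M.optimalUtility θ := by
    -- A real supremum has its meaning only for a bounded family; the lower bound `-C` on the regret
    -- bounds all utilities by `U* + C`.
    refine le_ciSup (f := fun g => M.utility (stationary M.horizon g) θ)
      ⟨M.optimalUtility θ + C, ?_⟩ g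
    rintro _ ⟨g', rfl⟩
    have := (abs_le.1 (hC (stationary M.horizon g') θ)).1
    simp only [regret] at this
    linarith
  refine le_of_forall_pos_le_add fun ε hε => ?_
  obtain ⟨g, n, hn, hgn⟩ := exists_measurable_selection_lt
    (fun g : {g : S → A // Measurable g} => M.regret (stationary M.horizon g))
    (fun g => hcont _) ε fun θ => by
      obtain ⟨g, hg⟩ := exists_lt_of_lt_ciSup
        (show M.optimalUtility θ - ε < M.optimalUtility θ by linarith)
      exact ⟨g, by simp only [regret]; linarith⟩
  simp only [regret] at hgn
  have hm : Measurable fun θ => M.utility (stationary M.horizon (g (n θ))) θ :=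
    measurable_countable_selection (F := fun k => M.utility (stationary M.horizon (g k)))
      (fun k => M.measurable_utility _) hn
  have hi : Integrable (fun θ => M.utility (stationary M.horizon (g (n θ))) θ) P := by
    refine (hU.abs.add (integrable_const ε)).mono' hm.aestronglyMeasurable
      (.of_forall fun θ => ?_)
    have h1 := hle (g (n θ)) θ
    have h2 := hgn θ
    simp only [Real.norm_eq_abs, Pi.add_apply]
    rw [abs_le]
    constructor <;> cases abs_cases (M.optimalUtility θ) <;> linarith
  have hmain := hf.le _ hi
  have h3 : ∫ θ, M.optimalUtility θ ∂P ≤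
      ∫ θ, (M.utility (stationary M.horizon (g (n θ))) θ + ε) ∂P :=
    integral_mono hU (hi.add (integrable_const ε)) fun θ => by
      have := hgn θ
      simp only
      linarith
  rw [integral_add hi (integrable_const ε)] at h3
  simp only [integral_const, probReal_univ, one_smul] at h3
  linarith

variable [StandardBorelSpace Y] [Nonempty Y] [StandardBorelSpace S] [Nonempty S]

/-- One step of the analysis of Thompson sampling: bounds for the gap between the optimal reward and
the reward predicted from the history bound the regret, and make the rewards integrable. -/
theorem IsOptimal.integral_starLaw_sub_integral_thompsonSampling_le (hf : M.IsOptimal P f)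
    (t : Fin M.horizon) (B : O × Hist S A Y t → ℝ≥0∞) {c : ℝ≥0∞} (hc : c ≠ ∞)
    (hnorm : ∀ᵐ p ∂M.thompsonHist P f t,
      Integrable (fun z => M.reward (z.1, f.1 (z.2, p.1))) (M.starLaw f t p.1) →
      ∫⁻ z, ‖M.reward (z.1, f.1 (z.2, p.1))‖ₑ ∂M.predictive P f t p.2 ≤
        ∫⁻ z, ‖M.reward (z.1, f.1 (z.2, p.1))‖ₑ ∂M.starLaw f t p.1 + B p + c)
    (hgap : ∀ᵐ p ∂M.thompsonHist P f t,
      Integrable (fun z => M.reward (z.1, f.1 (z.2, p.1))) (M.starLaw f t p.1) →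
      Integrable (fun z => M.reward (z.1, f.1 (z.2, p.1))) (M.predictive P f t p.2) →
      ENNReal.ofReal (∫ z, M.reward (z.1, f.1 (z.2, p.1)) ∂M.starLaw f t p.1 -
        ∫ z, M.reward (z.1, f.1 (z.2, p.1)) ∂M.predictive P f t p.2) ≤ B p)
    (hB : ∫⁻ p, B p ∂M.thompsonHist P f t ≠ ∞) :
    Integrable M.stageReward (M.priorStageLaw P (M.thompsonSampling P f) t) ∧
      ∫ θ, ∫ z, M.reward (z.1, f.1 (z.2, θ)) ∂M.starLaw f t θ ∂P -
        ∫ x, M.stageReward x ∂M.priorStageLaw P (M.thompsonSampling P f) t ≤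
        (∫⁻ p, B p ∂M.thompsonHist P f t).toReal := by
  have hfm := f.2
  have hr := M.measurable_reward
  have hfst : (M.thompsonHist P f t).map Prod.fst = P := M.thompsonHist_fst P f t
  have hstar : ∀ᵐ p ∂M.thompsonHist P f t,
      Integrable (fun z => M.reward (z.1, f.1 (z.2, p.1))) (M.starLaw f t p.1) := by
    have := hf.ae_integrable_starLaw t
    rw [← hfst] at this
    exact ae_of_ae_map measurable_fst.aemeasurable this
  have hmN : Measurable fun θ => ∫⁻ z, ‖M.reward (z.1, f.1 (z.2, θ))‖ₑ ∂M.starLaw f t θ :=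
    Measurable.lintegral_kernel_prod_right' (κ := M.starLaw f t)
      (f := fun x : O × (Y × S) => ‖M.reward (x.2.1, f.1 (x.2.2, x.1))‖ₑ) (by fun_prop)
  -- Integrability under the prior is derived here from that of the optimal rewards, using `hnorm`
  -- and the finite integral of `B`.
  have hint : Integrable (fun x => M.reward (x.2.1, f.1 (x.2.2, x.1.1)))
      (M.decoupledLaw P f t) := by
    refine ⟨Measurable.aestronglyMeasurable (by fun_prop), ?_⟩
    rw [HasFiniteIntegral, decoupledLaw, Measure.lintegral_compProd (by fun_prop)]
    simp only [Kernel.comap_apply]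
    calc ∫⁻ p, ∫⁻ z, ‖M.reward (z.1, f.1 (z.2, p.1))‖ₑ ∂M.predictive P f t p.2
          ∂M.thompsonHist P f t
        ≤ ∫⁻ p, (∫⁻ z, ‖M.reward (z.1, f.1 (z.2, p.1))‖ₑ ∂M.starLaw f t p.1 + B p + c)
          ∂M.thompsonHist P f t := by
          refine lintegral_mono_ae ?_
          filter_upwards [hnorm, hstar] with p h1 h2 using h1 h2
      _ = ∫⁻ θ, ∫⁻ z, ‖M.reward (z.1, f.1 (z.2, θ))‖ₑ ∂M.starLaw f t θ ∂P +
          ∫⁻ p, B p ∂M.thompsonHist P f t + c := by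
          rw [lintegral_add_right _ measurable_const,
            lintegral_add_left (by exact hmN.comp measurable_fst)]
          have hN := lintegral_map (μ := M.thompsonHist P f t) hmN measurable_fst
          rw [hfst] at hN
          rw [hN, lintegral_const, measure_univ, mul_one]
      _ < ∞ := by
          have := hf.lintegral_enorm_starLaw_ne_top t
          exact lt_top_iff_ne_top.2 (ENNReal.add_ne_top.2 ⟨ENNReal.add_ne_top.2 ⟨this, hB⟩, hc⟩)
  refine ⟨(M.integrable_thompsonSampling_iff P f t).2 hint, ?_⟩
  have hJ := hf.integrable_integral_starLaw t
  have hJ' : Integrable (fun p => ∫ z, M.reward (z.1, f.1 (z.2, p.1)) ∂M.starLaw f t p.1)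
      (M.thompsonHist P f t) := by
    rw [← hfst] at hJ
    exact hJ.comp_measurable measurable_fst
  have hJe : ∫ θ, ∫ z, M.reward (z.1, f.1 (z.2, θ)) ∂M.starLaw f t θ ∂P =
      ∫ p, ∫ z, M.reward (z.1, f.1 (z.2, p.1)) ∂M.starLaw f t p.1 ∂M.thompsonHist P f t := by
    conv_lhs => rw [← hfst]
    refine integral_map measurable_fst.aemeasurable ?_
    rw [hfst]
    exact hJ.1
  have hpred := (Measure.integrable_compProd_iff hint.1).1 hint
  simp only [Kernel.comap_apply] at hpred
  have hV : Integrable (fun p => ∫ z, M.reward (z.1, f.1 (z.2, p.1)) ∂M.predictive P f t p.2)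
      (M.thompsonHist P f t) := by
    refine hpred.2.mono' ?_ (.of_forall fun p => norm_integral_le_integral_norm _)
    have : StronglyMeasurable fun x : (O × Hist S A Y t) × (Y × S) =>
        M.reward (x.2.1, f.1 (x.2.2, x.1.1)) := Measurable.stronglyMeasurable (by fun_prop)
    exact (this.integral_kernel_prod_right'
      (κ := (M.predictive P f t).comap Prod.snd measurable_snd)).aestronglyMeasurable
  have hVe : ∫ x, M.reward (x.2.1, f.1 (x.2.2, x.1.1)) ∂M.decoupledLaw P f t =
      ∫ p, ∫ z, M.reward (z.1, f.1 (z.2, p.1)) ∂M.predictive P f t p.2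
        ∂M.thompsonHist P f t :=
    Measure.integral_compProd hint
  rw [integral_thompsonSampling, hJe, hVe, ← integral_sub hJ' hV]
  refine integral_le_toReal_lintegral (hJ'.sub hV) hB ?_
  filter_upwards [hgap, hstar, hpred.1] with p h1 h2 h3 using h1 h2 h3

/-- Some policy has Bayesian regret at most the sum of the bounds for the gaps of Thompson
sampling. -/
theorem IsOptimal.exists_policy_integral_regret_le (hf : M.IsOptimal P f)
    (hbdd : ∃ C : ℝ, ∀ π θ, |M.regret π θ| ≤ C) (hcont : ∀ π, Continuous fun θ => M.regret π θ)
    (B : (t : Fin M.horizon) → O × Hist S A Y t → ℝ≥0∞) (c : Fin M.horizon → ℝ≥0∞)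
    (hc : ∀ t, c t ≠ ∞)
    (hnorm : ∀ t : Fin M.horizon, ∀ᵐ p ∂M.thompsonHist P f t,
      Integrable (fun z => M.reward (z.1, f.1 (z.2, p.1))) (M.starLaw f t p.1) →
      ∫⁻ z, ‖M.reward (z.1, f.1 (z.2, p.1))‖ₑ ∂M.predictive P f t p.2 ≤
        ∫⁻ z, ‖M.reward (z.1, f.1 (z.2, p.1))‖ₑ ∂M.starLaw f t p.1 + B t p + c t)
    (hgap : ∀ t : Fin M.horizon, ∀ᵐ p ∂M.thompsonHist P f t,
      Integrable (fun z => M.reward (z.1, f.1 (z.2, p.1))) (M.starLaw f t p.1) →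
      Integrable (fun z => M.reward (z.1, f.1 (z.2, p.1))) (M.predictive P f t p.2) →
      ENNReal.ofReal (∫ z, M.reward (z.1, f.1 (z.2, p.1)) ∂M.starLaw f t p.1 -
        ∫ z, M.reward (z.1, f.1 (z.2, p.1)) ∂M.predictive P f t p.2) ≤ B t p)
    (hB : ∑ t : Fin M.horizon, ∫⁻ p, B t p ∂M.thompsonHist P f t ≠ ∞) :
    ∃ π, ∫ θ, M.regret π θ ∂P ≤
      (∑ t : Fin M.horizon, ∫⁻ p, B t p ∂M.thompsonHist P f t).toReal := by
  have hBt (t : Fin M.horizon) : ∫⁻ p, B t p ∂M.thompsonHist P f t ≠ ∞ :=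
    (ENNReal.sum_ne_top.1 hB) t (Finset.mem_univ t)
  have hstep (t : Fin M.horizon) := hf.integral_starLaw_sub_integral_thompsonSampling_le t (B t)
    (hc t) (hnorm t) (hgap t) (hBt t)
  -- A deterministic policy at least as good as Thompson sampling under this prior.
  obtain ⟨π, hπ, hle⟩ := M.exists_policy_integral_le P (volume : Measure unitInterval)
    (M.thompsonSampling P f) M.horizon (M.exists_map_eq_thompsonSampling P f) fun t => (hstep t).1
  refine ⟨π, ?_⟩
  have h1 := hf.integral_optimalUtility_le hbdd hcont
  have h2 := Finset.sum_le_sum fun t (_ : t ∈ Finset.univ) => (hstep t).2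
  rw [Finset.sum_sub_distrib, ← hf.integral_utility_slice] at h2
  rw [ENNReal.toReal_sum fun t _ => hBt t]
  unfold regret
  rw [integral_sub (hf.integrable_optimalUtility hbdd hcont) (integrable_utility hπ),
    integral_utility hπ]
  linarith

end Compact

end MDPClass

end

/-! ### The two bounds -/

theorem theorem2 {S A Y O : Type*}
    [MeasurableSpace S] [StandardBorelSpace S] [Nonempty S]
    [MeasurableSpace A]
    [MeasurableSpace Y] [StandardBorelSpace Y] [Nonempty Y]
    [MetricSpace O] [CompactSpace O] [Nonempty O] [MeasurableSpace O] [BorelSpace O]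
    (M : MDPClass S A Y O)
    -- the conditions for minimax duality
    [MetricSpace (Policy S A Y M.horizon)] [MeasurableSpace (Policy S A Y M.horizon)]
    [BorelSpace (Policy S A Y M.horizon)]
    (hint : M.RewardsIntegrable)
    (hmeas : ∀ θ, Measurable fun π => M.regret π θ)
    (hbdd : ∃ C : ℝ, ∀ π θ, |M.regret π θ| ≤ C)
    (hcont : ∀ π, Continuous fun θ => M.regret π θ)
    -- for every prior, a maximiser of the expected utility
    (fstar : ProbabilityMeasure O → {f : S × O → A // Measurable f})
    (hfstar : ∀ P : ProbabilityMeasure O, M.IsOptimal (P : Measure O) (fstar P)) :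
    (∀ σ : Fin M.horizon → ℝ≥0, (∀ t, 0 < σ t) →
      (∀ (P : ProbabilityMeasure O) (t : Fin M.horizon),
        ∀ᵐ h ∂((M.thompsonHist (P : Measure O) (fstar P) t).snd), ∀ θ : O,
          MDPClass.IsSubGaussian (fun z : Y × S => M.reward (z.1, (fstar P).1 (z.2, θ)))
            (σ t ^ 2) (M.predictive (P : Measure O) (fstar P) t h)) →
      M.minimaxRegret ≤
        ⨆ P : ProbabilityMeasure O, ((∑ t : Fin M.horizon,
          ∫⁻ x, (2 * (σ t : ℝ≥0∞) ^ 2 *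
              klDiv (M.starLaw (fstar P) t x.1)
                (M.predictive (P : Measure O) (fstar P) t x.2)) ^ (1 / 2 : ℝ)
            ∂(M.thompsonHist (P : Measure O) (fstar P) t) : ℝ≥0∞) : EReal)) ∧
    (∀ [MetricSpace (Y × A)] [SecondCountableTopology (Y × A)] [BorelSpace (Y × A)] (L : ℝ≥0),
      LipschitzWith L M.reward →
      M.minimaxRegret ≤
        ⨆ P : ProbabilityMeasure O, (((L : ℝ≥0∞) * ∑ t : Fin M.horizon,
          ∫⁻ x, transportCost
              (fun z z' : Y × S =>
                edist (z.1, (fstar P).1 (z.2, x.1)) (z'.1, (fstar P).1 (z'.2, x.1)))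
              (M.starLaw (fstar P) t x.1)
              (M.predictive (P : Measure O) (fstar P) t x.2)
            ∂(M.thompsonHist (P : Measure O) (fstar P) t) : ℝ≥0∞) : EReal)) := by
  have hPol : Nonempty (Policy S A Y M.horizon) :=
    let ⟨θ⟩ := ‹Nonempty O›
    ⟨MDPClass.stationary M.horizon (MDPClass.slice (fstar ⟨Measure.dirac θ, inferInstance⟩) θ)⟩
  refine ⟨fun σ hσ hsub => ?_, fun L hL => ?_⟩
  · refine MDPClass.minimaxRegret_le_iSup hmeas hbdd hcont _ fun P hP => ?_
    -- The hypothesis holds for almost every history and all `θ` at once, so it may be applied at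
    -- the true parameter.
    have hsub' (t : Fin M.horizon) :=
      ae_of_ae_map measurable_snd.aemeasurable (hsub P t)
    refine (hfstar P).exists_policy_integral_regret_le hbdd hcont _
      (fun t => ENNReal.ofReal (2 * Real.exp ((σ t ^ 2 : ℝ≥0) / 2)))
      (fun _ => ENNReal.ofReal_ne_top) (fun t => ?_) (fun t => ?_) hP
    · filter_upwards [hsub' t] with p hp hi using (hp p.1).lintegral_enorm_le (hσ t) hi
    · filter_upwards [hsub' t] with p hp hi _
      exact (ENNReal.ofReal_le_ofReal (le_abs_self _)).trans
        ((hp p.1).ofReal_abs_integral_sub_le (hσ t) hi)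
  · refine MDPClass.minimaxRegret_le_iSup hmeas hbdd hcont _ fun P hP => ?_
    -- `L` is finite, so it moves inside the integrals without measurability of the transport cost.
    simp only [Finset.mul_sum, ← lintegral_const_mul' _ _ ENNReal.coe_ne_top] at hP ⊢
    refine (hfstar P).exists_policy_integral_regret_le hbdd hcont _ (fun _ => 0)
      (fun _ => ENNReal.zero_ne_top) (fun t => .of_forall fun p _ => ?_)
      (fun t => .of_forall fun p hi hi' => ?_) hP
    · rw [add_zero]
      exact lintegral_enorm_le_add_transportCost
        (M.measurable_reward.comp (MDPClass.measurable_outcome_optimalAction (fstar P) p.1))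
        fun z z' => hL _ _
    · exact ofReal_integral_sub_le_transportCost (fun z z' => hL _ _) hi hi'
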